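/- Let $N\ge 3$, let $a<\frac{N-2}{2}$, $a\le b<a+1$, and $p=\frac{2N}{N-2(1+a-b)}$. Let $\mathcal D^{1,2}_a(\mathbb R^N)$ be the completion of $C_0^\infty(\mathbb R^N)$ with respect to the norm $\left(\int_{\mathbb R^N}|x|^{-2a}|\nabla u|^2\,dx\right)^{1/2}$, regarded as a space of functions modulo equality almost everywhere. Let $K\in C^1(\mathbb R^N)\cap L^\infty(\mathbb R^N)$ be such that $x\mapsto\nabla K(x)\cdot x$ is bounded on $\mathbb R^N$. Consider the equation $$-\operatorname{div}(|x|^{-2a}\nabla u)=K(x)\frac{u^{p-1}}{|x|^{bp}}\quad\text{in }\mathbb R^N. \qquad (*)$$ A positive weak solution of $(*)$ is a $u\in\mathcal D^{1,2}_a(\mathbb R^N)$ with $u>0$ almost everywhere and $$\int_{\mathbb R^N}|x|^{-2a}\,\nabla u\cdot\nabla\varphi\,dx=\int_{\mathbb R^N}K(x)\frac{u^{p-1}}{|x|^{bp}}\,\varphi\,dx\qquad\text{for all }\varphi\in C_0^\infty(\mathbb R^N).$$ (i) If $u$ is a positive weak solution of $(*)$, then $(\nabla K(x)\cdot x)\,u^p|x|^{-bp}$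 is integrable on $\mathbb R^N$ and $$\int_{\mathbb R^N}(\nabla K(x)\cdot x)\,\frac{u^p}{|x|^{bp}}\,dx=0.$$ (ii) If $\nabla K(x)\cdot x\ge 0$ for all $x\in\mathbb R^N$, or $\nabla K(x)\cdot x\le 0$ for all $x\in\mathbb R^N$, and $K$ is not constant, then $(*)$ has no positive weak solution. -/

import Mathlib

open MeasureTheory Filter Topology
open scoped ContDiff

/-- `φ` belongs to `C_0^∞(ℝ^N)`: it is smooth with compact support. -/
def IsTestFunction {N : ℕ} (φ : EuclideanSpace ℝ (Fin N) → ℝ) : Prop :=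
  ContDiff ℝ ∞ φ ∧ HasCompactSupport φ

/-- `u` belongs to `D^{1,2}_a(ℝ^N)` and has gradient `G`.

The space `D^{1,2}_a(ℝ^N)` is the completion of `C_0^∞(ℝ^N)` in the norm
`(∫ |x|^{-2a} |∇φ|² dx)^{1/2}`. For `a < (N - 2) / 2` it is a space of functions (modulo equality
almost everywhere): an element is given by a Cauchy sequence of test functions `φ n` in this norm,
that is, one whose gradients converge to some `G` in `L²(|x|^{-2a} dx)`, and it is identified with
the function `u` to which (a subsequence of) `φ n` converges almost everywhere. -/
def HasGradientInD {N : ℕ} (a : ℝ) (u : EuclideanSpace ℝ (Fin N) → ℝ)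
    (G : EuclideanSpace ℝ (Fin N) → EuclideanSpace ℝ (Fin N)) : Prop :=
  AEStronglyMeasurable G volume ∧
  ∃ φ : ℕ → EuclideanSpace ℝ (Fin N) → ℝ,
    (∀ n, IsTestFunction (φ n)) ∧
    (∀ᵐ x, Tendsto (fun n => φ n x) atTop (𝓝 (u x))) ∧
    Tendsto
      (fun n => ∫⁻ x, ENNReal.ofReal (‖x‖ ^ (-(2 * a)) * ‖gradient (φ n) x - G x‖ ^ 2))
      atTop (𝓝 0)

/-- `u ∈ D^{1,2}_a(ℝ^N)` is a positive weak solution of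
`-div (|x|^{-2a} ∇u) = K(x) u^{p-1} / |x|^{bp}` on the whole of `ℝ^N`. -/
def IsPositiveWeakSolution {N : ℕ} (a b p : ℝ) (K u : EuclideanSpace ℝ (Fin N) → ℝ) : Prop :=
  (∀ᵐ x, 0 < u x) ∧
  ∃ G : EuclideanSpace ℝ (Fin N) → EuclideanSpace ℝ (Fin N),
    HasGradientInD a u G ∧
    ∀ φ : EuclideanSpace ℝ (Fin N) → ℝ, IsTestFunction φ →
      ∫ x, ‖x‖ ^ (-(2 * a)) * inner ℝ (G x) (gradient φ x) =
        ∫ x, K x * (u x ^ (p - 1) / ‖x‖ ^ (b * p)) * φ x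

open scoped ENNReal

/-! The proof tests the equation with differences of dilates, so it needs no regularity or decay of
`u` and produces no boundary terms. Put `u_t(x) = e^{αt} u(e^t x)` with `α = (N-2-2a)/2`. These maps
form a one-parameter group of isometries, both of `D^{1,2}_a` and of `L^p(|x|^{-bp} dx)`. Write
`E(t)` for the squared `D^{1,2}_a` norm of `u_t - u`.

Since `u_t` and `u` have equal norms, polarization and the equation give `E(t) = -2 ∫ K u^{p-1} (u_t
- u) |x|^{-bp}`. Expanding `s ↦ s^p` to first order therefore shows that `∫ K u_t^p |x|^{-bp} - ∫ K
u^p |x|^{-bp}` equals `-(p/2) E(t)` plus a remainder quadratic in `u_t - u`. If both are `O(t²)`, so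
is `∫ K(e^{-t}x) u^p |x|^{-bp} - ∫ K u^p |x|^{-bp}`, by a change of variables. The derivative at `0`
thus vanishes; up to sign it is the integral in (i).

The main point is `E(t) = O(t²)` (`exists_energy_le_sq`). Averaging the formulas for `E(t)` and
`E(-t)` gives `E(t) = ∫ (K(e^t x) u_t^{p-1} - K u^{p-1}) (u_t - u) |x|^{-bp}`
(`toReal_energy_eq_integral`). The variation of `K` contributes `O(|t| E(t)^{1/2})`. The rest is
controlled by integrals of `u^{p-2} (u_t - u)²` and its dilate. Cutting the potential `u^{p-2}` at a
high level leaves a tail absorbed by `E(t)`, by Hölder and Caffarelli-Kohn-Nirenberg, and a part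
bounded relative to the Hardy weight (`exists_lintegral_potential_le`). The Hardy norm of `u_t - u`
is `O(|t|)` by Hardy's inequality alone.

For (ii), a sign on `∇K · x` and `u > 0` force `∇K · x = 0`, so `K` is constant on rays and equals
`K 0`. -/

/-- Euclidean space of dimension `N`. -/
abbrev Euc (N : ℕ) := EuclideanSpace ℝ (Fin N)

/-- The measure `|x|^s dx`. -/
noncomputable def powMeasure (N : ℕ) (s : ℝ) : Measure (Euc N) :=
  volume.withDensity fun x => ENNReal.ofReal (‖x‖ ^ s)

/-- The dilation `x ↦ e^{κ t} f (e^t x)`. -/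
noncomputable def dil {N : ℕ} {F : Type*} [NormedAddCommGroup F] [NormedSpace ℝ F]
    (κ t : ℝ) (f : Euc N → F) (x : Euc N) : F :=
  Real.exp (κ * t) • f (Real.exp t • x)

/-! ### Power weights and their scaling -/

section PowMeasure

variable {N : ℕ} {s : ℝ}

instance : SFinite (powMeasure N s) := by unfold powMeasure; infer_instance

theorem measurable_ofReal_norm_rpow (s : ℝ) :
    Measurable fun x : Euc N => ENNReal.ofReal (‖x‖ ^ s) := by fun_prop

theorem lintegral_powMeasure (f : Euc N → ℝ≥0∞) :
    ∫⁻ x, f x ∂powMeasure N s = ∫⁻ x, ENNReal.ofReal (‖x‖ ^ s) * f x :=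
  lintegral_withDensity_eq_lintegral_mul_non_measurable _ (measurable_ofReal_norm_rpow s)
    (Eventually.of_forall fun _ => ENNReal.ofReal_lt_top) f

theorem integral_powMeasure {F : Type*} [NormedAddCommGroup F] [NormedSpace ℝ F] (f : Euc N → F) :
    ∫ x, f x ∂powMeasure N s = ∫ x, ‖x‖ ^ s • f x := by
  unfold powMeasure
  rw [integral_withDensity_eq_integral_toReal_smul (measurable_ofReal_norm_rpow s)
    (Eventually.of_forall fun _ => ENNReal.ofReal_lt_top)]
  refine integral_congr_ae (Eventually.of_forall fun x => ?_)
  simp only [ENNReal.toReal_ofReal (Real.rpow_nonneg (norm_nonneg x) s)]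

theorem integrable_powMeasure_iff {F : Type*} [NormedAddCommGroup F] [NormedSpace ℝ F]
    {f : Euc N → F} :
    Integrable f (powMeasure N s) ↔ Integrable fun x => ‖x‖ ^ s • f x := by
  unfold powMeasure
  rw [integrable_withDensity_iff_integrable_smul' (measurable_ofReal_norm_rpow s)
    (Eventually.of_forall fun _ => ENNReal.ofReal_lt_top)]
  refine integrable_congr (Eventually.of_forall fun x => ?_)
  simp only [ENNReal.toReal_ofReal (Real.rpow_nonneg (norm_nonneg x) s)]

theorem powMeasure_absolutelyContinuous : powMeasure N s ≪ volume :=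
  withDensity_absolutelyContinuous _ _

theorem ae_ne_zero_euc [NeZero N] : ∀ᵐ x : Euc N, x ≠ 0 := by
  have : Nontrivial (Euc N) := by
    apply Module.nontrivial_of_finrank_pos (R := ℝ)
    simpa using Nat.pos_of_ne_zero (NeZero.ne N)
  exact Measure.ae_ne volume 0

theorem ae_powMeasure_iff [NeZero N] {P : Euc N → Prop} :
    (∀ᵐ x ∂powMeasure N s, P x) ↔ ∀ᵐ x, P x := by
  unfold powMeasure
  rw [ae_withDensity_iff (measurable_ofReal_norm_rpow s)]
  refine ⟨fun h => ?_, fun h => h.mono fun _ hx _ => hx⟩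
  filter_upwards [h, ae_ne_zero_euc] with x hx h0
  exact hx (by simpa using Real.rpow_pos_of_pos (norm_pos_iff.2 h0) s)

theorem aestronglyMeasurable_powMeasure {F : Type*} [TopologicalSpace F]
    {f : Euc N → F} (hf : AEStronglyMeasurable f volume) :
    AEStronglyMeasurable f (powMeasure N s) :=
  hf.mono_ac powMeasure_absolutelyContinuous

theorem lintegral_rpow_mul_powMeasure [NeZero N] (r : ℝ) (f : Euc N → ℝ≥0∞) :
    ∫⁻ x, ENNReal.ofReal (‖x‖ ^ r) * f x ∂powMeasure N s = ∫⁻ x, f x ∂powMeasure N (s + r) := by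
  rw [lintegral_powMeasure, lintegral_powMeasure]
  refine lintegral_congr_ae ?_
  filter_upwards [ae_ne_zero_euc] with x hx
  rw [← mul_assoc, ← ENNReal.ofReal_mul (by positivity), Real.rpow_add (norm_pos_iff.2 hx)]

/-- The Jacobian contributes `c^{-N}` and the homogeneity of the weight contributes `c^{-s}`. -/
theorem map_smul_powMeasure {c : ℝ} (hc : 0 < c) :
    (powMeasure N s).map (c • ·) = ENNReal.ofReal (c ^ (-(N + s))) • powMeasure N s := by
  ext A hA
  have hme : MeasurableEmbedding fun x : Euc N => c • x :=
    (Homeomorph.smulOfNeZero c hc.ne').measurableEmbedding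
  rw [hme.map_apply, Measure.smul_apply, ← lintegral_indicator_one (hme.measurable hA),
    ← lintegral_indicator_one hA, lintegral_powMeasure, lintegral_powMeasure]
  have h1 : ∀ x : Euc N, ENNReal.ofReal (‖x‖ ^ s) * ((fun x => c • x) ⁻¹' A).indicator 1 x =
      ENNReal.ofReal (c ^ (-s)) * (fun y => ENNReal.ofReal (‖y‖ ^ s) * A.indicator 1 y) (c • x) := by
    intro x
    have : ‖x‖ ^ s = c ^ (-s) * ‖c • x‖ ^ s := by
      rw [norm_smul, Real.norm_of_nonneg hc.le, Real.mul_rpow hc.le (norm_nonneg _), ← mul_assoc,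
        ← Real.rpow_add hc]
      simp
    rw [this, ENNReal.ofReal_mul (by positivity), mul_assoc]
    rfl
  rw [lintegral_congr h1, lintegral_const_mul' _ _ ENNReal.ofReal_ne_top,
    ← hme.lintegral_map (fun y => ENNReal.ofReal (‖y‖ ^ s) * A.indicator 1 y),
    Measure.map_addHaar_smul _ hc.ne', lintegral_smul_measure, smul_eq_mul, ← mul_assoc,
    ← ENNReal.ofReal_mul (by positivity), smul_eq_mul]
  congr 2
  rw [abs_of_nonneg (by positivity), neg_add, Real.rpow_add hc, mul_comm, Real.rpow_neg hc.le]
  simp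

theorem measurableEmbedding_exp_smul (t : ℝ) :
    MeasurableEmbedding fun x : Euc N => Real.exp t • x :=
  (Homeomorph.smulOfNeZero (Real.exp t) (Real.exp_ne_zero t)).measurableEmbedding

theorem map_exp_smul_powMeasure (t : ℝ) :
    (powMeasure N s).map (Real.exp t • ·) =
      ENNReal.ofReal (Real.exp (-(N + s) * t)) • powMeasure N s := by
  rw [map_smul_powMeasure (Real.exp_pos t), ← Real.exp_mul, mul_comm]

theorem lintegral_comp_exp_smul (t : ℝ) (f : Euc N → ℝ≥0∞) :
    ∫⁻ x, f (Real.exp t • x) ∂powMeasure N s =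
      ENNReal.ofReal (Real.exp (-(N + s) * t)) * ∫⁻ x, f x ∂powMeasure N s := by
  rw [← (measurableEmbedding_exp_smul t).lintegral_map, map_exp_smul_powMeasure,
    lintegral_smul_measure, smul_eq_mul]

theorem integral_comp_exp_smul (t : ℝ) (f : Euc N → ℝ) :
    ∫ x, f (Real.exp t • x) ∂powMeasure N s =
      Real.exp (-(N + s) * t) * ∫ x, f x ∂powMeasure N s := by
  rw [← (measurableEmbedding_exp_smul t).integral_map, map_exp_smul_powMeasure,
    integral_smul_measure, ENNReal.toReal_ofReal (Real.exp_pos _).le, smul_eq_mul]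

theorem quasiMeasurePreserving_exp_smul (t : ℝ) :
    Measure.QuasiMeasurePreserving (fun x : Euc N => Real.exp t • x) volume volume := by
  refine ⟨(measurableEmbedding_exp_smul t).measurable, ?_⟩
  rw [Measure.map_addHaar_smul _ (Real.exp_ne_zero t)]
  exact Measure.smul_absolutelyContinuous

end PowMeasure

/-! ### The dilation group -/

section Dil

variable {N : ℕ} {s : ℝ} {F : Type*} [NormedAddCommGroup F] [NormedSpace ℝ F]

theorem dil_dil (κ t r : ℝ) (f : Euc N → F) : dil κ t (dil κ r f) = dil κ (t + r) f := by
  ext x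
  simp only [dil, smul_smul, ← Real.exp_add]
  ring_nf

theorem dil_zero (κ : ℝ) (f : Euc N → F) : dil κ 0 f = f := by
  ext x
  simp [dil]

theorem dil_sub (κ t : ℝ) (f g : Euc N → F) : dil κ t (f - g) = dil κ t f - dil κ t g := by
  ext x
  simp [dil, smul_sub]

/-- The condition `κ q = N + s` says that the amplitude factor `e^{κqt}` cancels the scaling of the
measure. It is used with `q = 2` for gradients and with `q = p` for functions. -/
theorem lintegral_enorm_dil_rpow {κ q : ℝ} (hq : 0 ≤ q) (h : κ * q = N + s) (t : ℝ)
    (f : Euc N → F) :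
    ∫⁻ x, ‖dil κ t f x‖ₑ ^ q ∂powMeasure N s = ∫⁻ x, ‖f x‖ₑ ^ q ∂powMeasure N s := by
  have h1 : ∀ x, ‖dil κ t f x‖ₑ ^ q =
      ENNReal.ofReal (Real.exp ((N + s) * t)) * (fun y => ‖f y‖ₑ ^ q) (Real.exp t • x) := by
    intro x
    rw [dil, enorm_smul, ENNReal.mul_rpow_of_nonneg _ _ hq, Real.enorm_of_nonneg (Real.exp_pos _).le,
      ENNReal.ofReal_rpow_of_pos (Real.exp_pos _), ← Real.exp_mul, ← h]
    ring_nf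
  rw [lintegral_congr h1, lintegral_const_mul' _ _ ENNReal.ofReal_ne_top,
    lintegral_comp_exp_smul t fun y => ‖f y‖ₑ ^ q, ← mul_assoc,
    ← ENNReal.ofReal_mul (Real.exp_pos _).le, ← Real.exp_add]
  ring_nf
  simp

theorem lintegral_enorm_dil_sq {κ : ℝ} (h : 2 * κ = N + s) (t : ℝ) (f : Euc N → F) :
    ∫⁻ x, ‖dil κ t f x‖ₑ ^ 2 ∂powMeasure N s = ∫⁻ x, ‖f x‖ₑ ^ 2 ∂powMeasure N s := by
  have := lintegral_enorm_dil_rpow (q := 2) (by norm_num) (by linarith) t f (s := s) (κ := κ)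
  simpa [ENNReal.rpow_ofNat] using this

theorem aestronglyMeasurable_dil {f : Euc N → F} (hf : AEStronglyMeasurable f volume)
    (κ t : ℝ) : AEStronglyMeasurable (dil κ t f) volume :=
  (hf.comp_quasiMeasurePreserving (quasiMeasurePreserving_exp_smul t)).const_smul _

end Dil

/-! ### Elementary inequalities for extended nonnegative integrals -/

theorem sq_lintegral_mul_le {α : Type*} [MeasurableSpace α] {μ : Measure α} {f g : α → ℝ≥0∞}
    (hf : AEMeasurable f μ) (hg : AEMeasurable g μ) :
    (∫⁻ x, f x * g x ∂μ) ^ 2 ≤ (∫⁻ x, f x ^ 2 ∂μ) * ∫⁻ x, g x ^ 2 ∂μ := by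
  have h := ENNReal.lintegral_mul_norm_pow_le (μ := μ) (hf.pow_const 2) (hg.pow_const 2)
    (p := 1 / 2) (q := 1 / 2) (by norm_num) (by norm_num) (by norm_num)
  have e : ∀ z : ℝ≥0∞, (z ^ 2) ^ (1 / 2 : ℝ) = z := fun z => by
    rw [← ENNReal.rpow_natCast, ← ENNReal.rpow_mul]; norm_num
  have e' : ∀ z : ℝ≥0∞, (z ^ (1 / 2 : ℝ)) ^ 2 = z := fun z => by
    rw [← ENNReal.rpow_natCast, ← ENNReal.rpow_mul]; norm_num
  simp only [e] at h
  calc _ ≤ _ := pow_le_pow_left₀ zero_le h 2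
    _ = _ := by rw [mul_pow, e', e']

theorem add_sq_le_two_mul (x y : ℝ≥0∞) : (x + y) ^ 2 ≤ 2 * (x ^ 2 + y ^ 2) := by
  have h := ENNReal.rpow_add_le_mul_rpow_add_rpow x y (p := 2) (by norm_num)
  norm_num [ENNReal.rpow_ofNat] at h
  exact h

theorem enorm_add_sq_le {F : Type*} [NormedAddCommGroup F] (x y : F) :
    ‖x + y‖ₑ ^ 2 ≤ 2 * (‖x‖ₑ ^ 2 + ‖y‖ₑ ^ 2) :=
  (pow_le_pow_left₀ zero_le (enorm_add_le x y) 2).trans (add_sq_le_two_mul _ _)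

theorem enorm_inner_le {F : Type*} [NormedAddCommGroup F] [InnerProductSpace ℝ F] (x y : F) :
    ‖(inner ℝ x y : ℝ)‖ₑ ≤ ‖x‖ₑ * ‖y‖ₑ := by
  rw [← ofReal_norm, ← ofReal_norm, ← ofReal_norm,
    ← ENNReal.ofReal_mul (norm_nonneg _)]
  exact ENNReal.ofReal_le_ofReal (norm_inner_le_norm x y)

theorem continuous_gradient {F : Type*} [NormedAddCommGroup F] [InnerProductSpace ℝ F]
    [CompleteSpace F] {φ : F → ℝ} (hφ : ContDiff ℝ 1 φ) : Continuous (gradient φ) :=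
  (InnerProductSpace.toDual ℝ F).symm.continuous.comp (hφ.continuous_fderiv one_ne_zero)

/-! ### The generator of the dilations and Hardy's inequality -/

section Euler

variable {N : ℕ} {s : ℝ}

/-- The generator `κ φ + x · ∇φ` of the dilations. -/
noncomputable def euler (κ : ℝ) (φ : Euc N → ℝ) (x : Euc N) : ℝ :=
  κ * φ x + inner ℝ (gradient φ x) x

theorem continuous_euler {φ : Euc N → ℝ} (hφ : ContDiff ℝ 1 φ) (κ : ℝ) :
    Continuous (euler κ φ) :=
  (continuous_const.mul hφ.continuous).add ((continuous_gradient hφ).inner continuous_id)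

theorem hasDerivAt_dil {φ : Euc N → ℝ} (hφ : ContDiff ℝ 1 φ) (κ t : ℝ) (x : Euc N) :
    HasDerivAt (fun r => dil κ r φ x) (dil κ t (euler κ φ) x) t := by
  have h1 : HasDerivAt (fun r => Real.exp r • x) (Real.exp t • x) t :=
    (Real.hasDerivAt_exp t).smul_const x
  have h2 : HasFDerivAt φ (fderiv ℝ φ (Real.exp t • x)) (Real.exp t • x) :=
    (hφ.differentiable one_ne_zero _).hasFDerivAt
  have h3 : HasDerivAt (fun r => Real.exp (κ * r)) (Real.exp (κ * t) * κ) t := by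
    simpa using ((hasDerivAt_id t).const_mul κ).exp
  have h4 := h3.mul (h2.comp_hasDerivAt t h1)
  refine h4.congr_deriv ?_
  simp only [dil, euler, inner_gradient_left, Function.comp_apply, smul_eq_mul]
  ring

theorem continuous_dil_uncurry {f : Euc N → ℝ} (hf : Continuous f) (κ : ℝ) :
    Continuous fun z : Euc N × ℝ => dil κ z.2 f z.1 := by
  unfold dil
  fun_prop

theorem continuous_dil_left {f : Euc N → ℝ} (hf : Continuous f) (κ : ℝ) (x : Euc N) :
    Continuous fun t => dil κ t f x :=
  (continuous_dil_uncurry hf κ).comp (by fun_prop : Continuous fun t : ℝ => (x, t))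

theorem dil_sub_eq_integral {φ : Euc N → ℝ} (hφ : ContDiff ℝ 1 φ) (κ t : ℝ) (x : Euc N) :
    dil κ t φ x - φ x = ∫ r in (0 : ℝ)..t, dil κ r (euler κ φ) x := by
  rw [intervalIntegral.integral_eq_sub_of_hasDerivAt (fun r _ => hasDerivAt_dil hφ κ r x)
    ((continuous_dil_left (continuous_euler hφ κ) κ x).intervalIntegrable _ _), dil_zero]

theorem enorm_dil_sub_le {φ : Euc N → ℝ} (hφ : ContDiff ℝ 1 φ) (κ t : ℝ) (x : Euc N) :
    ‖dil κ t φ x - φ x‖ₑ ≤ ∫⁻ r in Set.uIoc 0 t, ‖dil κ r (euler κ φ) x‖ₑ := by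
  rw [dil_sub_eq_integral hφ]
  calc _ = ‖∫ r in Set.uIoc 0 t, dil κ r (euler κ φ) x‖ₑ := by
        rw [← ofReal_norm, intervalIntegral.norm_intervalIntegral_eq,
          ofReal_norm]
    _ ≤ _ := enorm_integral_le_lintegral_enorm _

theorem exists_smul_notMem_tsupport {φ : Euc N → ℝ} (hφ : HasCompactSupport φ) {x : Euc N}
    (hx : x ≠ 0) : ∃ S : ℝ, 0 ≤ S ∧ φ (Real.exp S • x) = 0 := by
  obtain ⟨R, hR⟩ := hφ.isCompact.isBounded.exists_norm_le
  have h1 : Tendsto (fun S => Real.exp S * ‖x‖) atTop atTop :=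
    Real.tendsto_exp_atTop.atTop_mul_const (norm_pos_iff.2 hx)
  obtain ⟨S, hS, hS0⟩ := ((h1.eventually_gt_atTop R).and (eventually_ge_atTop 0)).exists
  refine ⟨S, hS0, ?_⟩
  by_contra h
  have := hR _ (subset_tsupport φ h)
  rw [norm_smul, Real.norm_of_nonneg (Real.exp_pos S).le] at this
  linarith

theorem lintegral_euler_zero_sq_le [NeZero N] (φ : Euc N → ℝ) :
    ∫⁻ x, ‖euler 0 φ x‖ₑ ^ 2 ∂powMeasure N s ≤
      ∫⁻ x, ‖gradient φ x‖ₑ ^ 2 ∂powMeasure N (s + 2) := by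
  rw [← lintegral_rpow_mul_powMeasure]
  refine lintegral_mono fun x => ?_
  simp only [euler, zero_mul, zero_add, Real.rpow_ofNat]
  rw [ENNReal.ofReal_pow (norm_nonneg x), ofReal_norm, ← mul_pow, mul_comm]
  exact pow_le_pow_left₀ zero_le (enorm_inner_le _ _) 2

theorem lintegral_exp_neg_mul_Ioi {c : ℝ} (hc : 0 < c) :
    ∫⁻ r in Set.Ioi (0 : ℝ), ENNReal.ofReal (Real.exp (-c * r)) = ENNReal.ofReal c⁻¹ := by
  rw [← ofReal_integral_eq_lintegral_ofReal (integrableOn_exp_mul_Ioi (by linarith) 0)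
    (Eventually.of_forall fun _ => (Real.exp_pos _).le), integral_exp_mul_Ioi (by linarith)]
  simp

/-- Hardy's inequality with weights. -/
theorem hardy [NeZero N] {α : ℝ} (hα : 0 < α) (hs : 2 * α = N + s) {φ : Euc N → ℝ}
    (hφ : ContDiff ℝ 1 φ) (hc : HasCompactSupport φ) :
    ∫⁻ x, ‖φ x‖ₑ ^ 2 ∂powMeasure N s ≤
      ENNReal.ofReal α⁻¹ ^ 2 * ∫⁻ x, ‖gradient φ x‖ₑ ^ 2 ∂powMeasure N (s + 2) := by
  have hce := continuous_euler hφ 0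
  -- Along the ray through `x`, `φ x` is an integral of `dil 0 r (euler 0 φ) x` over `r > 0`.
  -- Cauchy-Schwarz is applied after inserting `e^{-αr/2} e^{αr/2}`, the first factor being square
  -- integrable with integral `1/α`.
  have hw : Measurable fun r : ℝ => ENNReal.ofReal (Real.exp (-(α / 2) * r)) := by fun_prop
  have hp : ∀ r c : ℝ, ENNReal.ofReal (Real.exp (c / 2 * r)) ^ 2 =
      ENNReal.ofReal (Real.exp (c * r)) := by
    intro r c
    rw [← ENNReal.ofReal_pow (Real.exp_pos _).le, ← Real.exp_nat_mul]
    ring_nf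
  have h1 : ∀ x : Euc N, x ≠ 0 → ‖φ x‖ₑ ^ 2 ≤ ENNReal.ofReal α⁻¹ *
      ∫⁻ r in Set.Ioi (0 : ℝ), ENNReal.ofReal (Real.exp (α * r)) * ‖dil 0 r (euler 0 φ) x‖ₑ ^ 2 := by
    intro x hx
    obtain ⟨S, hS, hSx⟩ := exists_smul_notMem_tsupport hc hx
    have h2 : ‖φ x‖ₑ ≤ ∫⁻ r in Set.Ioi (0 : ℝ), ‖dil 0 r (euler 0 φ) x‖ₑ := by
      have := enorm_dil_sub_le hφ 0 S x
      rw [dil, hSx, smul_zero, zero_sub, enorm_neg, Set.uIoc_of_le hS] at this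
      exact this.trans (lintegral_mono_set Set.Ioc_subset_Ioi_self)
    have h3 : ∀ r : ℝ, ‖dil 0 r (euler 0 φ) x‖ₑ = ENNReal.ofReal (Real.exp (-(α / 2) * r)) *
        (ENNReal.ofReal (Real.exp (α / 2 * r)) * ‖dil 0 r (euler 0 φ) x‖ₑ) := by
      intro r
      rw [← mul_assoc, ← ENNReal.ofReal_mul (Real.exp_pos _).le, ← Real.exp_add]
      simp
    rw [lintegral_congr h3] at h2
    have hm := (continuous_dil_left hce 0 x).measurable.enorm
    have h4 := (pow_le_pow_left₀ zero_le h2 2).trans (sq_lintegral_mul_le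
      (μ := volume.restrict (Set.Ioi (0 : ℝ))) hw.aemeasurable
      ((by fun_prop : Measurable fun r : ℝ => ENNReal.ofReal (Real.exp (α / 2 * r))).mul
        hm).aemeasurable)
    simp only [mul_pow, hp, ← neg_div] at h4
    rwa [lintegral_exp_neg_mul_Ioi hα] at h4
  calc ∫⁻ x, ‖φ x‖ₑ ^ 2 ∂powMeasure N s
      ≤ ∫⁻ x, ENNReal.ofReal α⁻¹ * (∫⁻ r in Set.Ioi (0 : ℝ),
          ENNReal.ofReal (Real.exp (α * r)) * ‖dil 0 r (euler 0 φ) x‖ₑ ^ 2) ∂powMeasure N s :=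
        lintegral_mono_ae (ae_powMeasure_iff.2 (ae_ne_zero_euc.mono h1))
    _ = ENNReal.ofReal α⁻¹ * ∫⁻ r in Set.Ioi (0 : ℝ), ∫⁻ x,
          ENNReal.ofReal (Real.exp (α * r)) * ‖dil 0 r (euler 0 φ) x‖ₑ ^ 2 ∂powMeasure N s := by
        rw [lintegral_const_mul' _ _ ENNReal.ofReal_ne_top, lintegral_lintegral_swap]
        exact (Measurable.mul (by fun_prop)
          ((continuous_dil_uncurry hce 0).measurable.enorm.pow_const 2)).aemeasurable
    _ = ENNReal.ofReal α⁻¹ * ∫⁻ r in Set.Ioi (0 : ℝ), ENNReal.ofReal (Real.exp (-α * r)) *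
          ∫⁻ x, ‖euler 0 φ x‖ₑ ^ 2 ∂powMeasure N s := by
        -- Scaling produces `e^{-(N+s)r} = e^{-2αr}`, which beats the weight `e^{αr}` and leaves
        -- `e^{-αr}`; integrating in `r` gives the second factor `1/α`.
        congr 1
        refine lintegral_congr fun r => ?_
        rw [lintegral_const_mul' _ _ ENNReal.ofReal_ne_top]
        simp only [dil, zero_mul, Real.exp_zero, one_smul]
        rw [lintegral_comp_exp_smul r fun y => ‖euler 0 φ y‖ₑ ^ 2, ← mul_assoc,
          ← ENNReal.ofReal_mul (Real.exp_pos _).le, ← Real.exp_add, ← hs]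
        ring_nf
    _ = ENNReal.ofReal α⁻¹ ^ 2 * ∫⁻ x, ‖euler 0 φ x‖ₑ ^ 2 ∂powMeasure N s := by
        rw [lintegral_mul_const _ (by fun_prop), lintegral_exp_neg_mul_Ioi hα]
        ring
    _ ≤ _ := mul_le_mul' le_rfl (lintegral_euler_zero_sq_le φ)

/-- Hardy's constant `α^{-2}` cancels the coefficient `α²` of the zeroth order term, so the constant
is `2(1 + 1)`. -/
theorem lintegral_euler_sq_le [NeZero N] {α : ℝ} (hα : 0 < α) (hs : 2 * α = N + s) {φ : Euc N → ℝ}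
    (hφ : ContDiff ℝ 1 φ) (hc : HasCompactSupport φ) :
    ∫⁻ x, ‖euler α φ x‖ₑ ^ 2 ∂powMeasure N s ≤
      4 * ∫⁻ x, ‖gradient φ x‖ₑ ^ 2 ∂powMeasure N (s + 2) := by
  have h1 : ∀ x, ‖euler α φ x‖ₑ ^ 2 ≤
      2 * (ENNReal.ofReal α ^ 2 * ‖φ x‖ₑ ^ 2 + ‖euler 0 φ x‖ₑ ^ 2) := by
    intro x
    have := enorm_add_sq_le (α * φ x) (euler 0 φ x)
    rw [enorm_mul, mul_pow, Real.enorm_of_nonneg hα.le] at this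
    refine le_trans (le_of_eq ?_) this
    simp [euler]
  calc _ ≤ ∫⁻ x, 2 * (ENNReal.ofReal α ^ 2 * ‖φ x‖ₑ ^ 2 + ‖euler 0 φ x‖ₑ ^ 2) ∂powMeasure N s :=
        lintegral_mono h1
    _ = 2 * (ENNReal.ofReal α ^ 2 * ∫⁻ x, ‖φ x‖ₑ ^ 2 ∂powMeasure N s +
          ∫⁻ x, ‖euler 0 φ x‖ₑ ^ 2 ∂powMeasure N s) := by
        have := hφ.continuous.measurable
        rw [lintegral_const_mul' _ _ (by simp), lintegral_add_left (by fun_prop),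
          lintegral_const_mul' _ _ (by simp)]
    _ ≤ 2 * (ENNReal.ofReal α ^ 2 *
          (ENNReal.ofReal α⁻¹ ^ 2 * ∫⁻ x, ‖gradient φ x‖ₑ ^ 2 ∂powMeasure N (s + 2)) +
          ∫⁻ x, ‖gradient φ x‖ₑ ^ 2 ∂powMeasure N (s + 2)) := by
        exact mul_le_mul' le_rfl (add_le_add (mul_le_mul' le_rfl (hardy hα hs hφ hc))
          (lintegral_euler_zero_sq_le φ))
    _ = _ := by
        rw [← mul_assoc, ← mul_pow, ← ENNReal.ofReal_mul hα.le, mul_inv_cancel₀ hα.ne']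
        simp
        ring

/-- The dilations are Lipschitz in the dilation parameter, with respect to the Hardy norm. -/
theorem lintegral_dil_sub_sq_le_of_contDiff [NeZero N] {α : ℝ} (hα : 0 < α) (hs : 2 * α = N + s)
    {φ : Euc N → ℝ} (hφ : ContDiff ℝ 1 φ) (hc : HasCompactSupport φ) (t : ℝ) :
    ∫⁻ x, ‖dil α t φ x - φ x‖ₑ ^ 2 ∂powMeasure N s ≤
      ENNReal.ofReal |t| ^ 2 * (4 * ∫⁻ x, ‖gradient φ x‖ₑ ^ 2 ∂powMeasure N (s + 2)) := by
  have hce := continuous_euler hφ α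
  have hvol : volume (Set.uIoc 0 t) = ENNReal.ofReal |t| := by simp [Real.volume_uIoc]
  -- Cauchy-Schwarz on an interval of length `|t|` gives one factor `|t|`. The other comes from
  -- integrating in `r`, each slice having the same norm because `dil α r` is an isometry.
  have h1 : ∀ x, ‖dil α t φ x - φ x‖ₑ ^ 2 ≤
      ENNReal.ofReal |t| * ∫⁻ r in Set.uIoc 0 t, ‖dil α r (euler α φ) x‖ₑ ^ 2 := by
    intro x
    have := (pow_le_pow_left₀ zero_le (enorm_dil_sub_le hφ α t x) 2)
    have h2 := sq_lintegral_mul_le (μ := volume.restrict (Set.uIoc 0 t)) (f := fun _ => 1)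
      aemeasurable_const (continuous_dil_left hce α x).measurable.enorm.aemeasurable
    simp only [one_mul, one_pow, lintegral_const, Measure.restrict_apply_univ, hvol] at h2
    exact this.trans h2
  calc _ ≤ ∫⁻ x, ENNReal.ofReal |t| * (∫⁻ r in Set.uIoc 0 t, ‖dil α r (euler α φ) x‖ₑ ^ 2)
          ∂powMeasure N s := lintegral_mono h1
    _ = ENNReal.ofReal |t| * ∫⁻ r in Set.uIoc 0 t, ∫⁻ x, ‖dil α r (euler α φ) x‖ₑ ^ 2
          ∂powMeasure N s := by
        rw [lintegral_const_mul' _ _ ENNReal.ofReal_ne_top, lintegral_lintegral_swap]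
        exact ((continuous_dil_uncurry hce α).measurable.enorm.pow_const 2).aemeasurable
    _ = ENNReal.ofReal |t| ^ 2 * ∫⁻ x, ‖euler α φ x‖ₑ ^ 2 ∂powMeasure N s := by
        simp only [lintegral_enorm_dil_sq hs, lintegral_const, Measure.restrict_apply_univ, hvol]
        ring
    _ ≤ _ := mul_le_mul' le_rfl (lintegral_euler_sq_le hα hs hφ hc)

end Euler

/-- The Sobolev inequality in exponent two. -/
theorem exists_sobolev_const {N : ℕ} (hN : 3 ≤ N) {q : ℝ} (hq : q = 2 * N / (N - 2)) :
    ∃ C : ℝ≥0∞, C ≠ ⊤ ∧ ∀ v : Euc N → ℝ, ContDiff ℝ 1 v → HasCompactSupport v →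
      ∫⁻ x, ‖v x‖ₑ ^ q ≤ C * (∫⁻ x, ‖fderiv ℝ v x‖ₑ ^ 2) ^ (q / 2) := by
  have hN' : (3 : ℝ) ≤ N := by exact_mod_cast hN
  have hq0 : 0 < q := by rw [hq]; apply div_pos <;> linarith
  lift q to NNReal using hq0.le
  let C := SNormLESNormFDerivOfEqConst ℝ (volume : Measure (Euc N)) ((2 : NNReal) : ℝ)
  refine ⟨(C : ℝ≥0∞) ^ (q : ℝ), ENNReal.rpow_ne_top_of_nonneg hq0.le ENNReal.coe_ne_top, ?_⟩
  intro v hv hvc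
  have hfr : Module.finrank ℝ (Euc N) = N := by simp
  have h := eLpNorm_le_eLpNorm_fderiv_of_eq (volume : Measure (Euc N)) hv hvc (p := 2) (p' := q)
    (by norm_num) (by rw [hfr]; omega) (by
      rw [hfr, hq]
      push_cast
      field_simp)
  have hq0' : q ≠ 0 := by rintro rfl; simp at hq0
  rw [← eLpNorm_nnreal_pow_eq_lintegral hq0']
  refine (ENNReal.rpow_le_rpow h hq0.le).trans (le_of_eq ?_)
  rw [ENNReal.mul_rpow_of_nonneg _ _ hq0.le]
  congr 1
  have h2 := eLpNorm_nnreal_pow_eq_lintegral (f := fderiv ℝ v) (μ := (volume : Measure (Euc N)))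
    (p := 2) (by norm_num)
  have h3 : ∫⁻ x, ‖fderiv ℝ v x‖ₑ ^ 2 = eLpNorm (fderiv ℝ v) (2 : NNReal) volume ^ (2 : ℝ) := by
    rw [show (2 : ℝ) = ((2 : NNReal) : ℝ) by norm_num, h2]
    simp [ENNReal.rpow_ofNat]
  rw [h3, ← ENNReal.rpow_mul]
  congr 1
  ring

/-! ### A singular power cut off near the origin -/

section Cutoff

/-- The function `r ↦ r^{-a/2}` on `(0, ∞)`, cut off at `r ≤ δ`. -/
noncomputable def cutPow (a δ r : ℝ) : ℝ := Real.smoothTransition (r / δ - 1) * r ^ (-a / 2)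

variable {a δ r : ℝ}

theorem contDiff_cutPow (hδ : 0 < δ) : ContDiff ℝ 1 (cutPow a δ) := by
  rw [contDiff_iff_contDiffAt]
  intro r
  rcases lt_or_ge r δ with hr | hr
  · have : cutPow a δ =ᶠ[𝓝 r] fun _ => 0 := by
      filter_upwards [gt_mem_nhds hr] with y hy
      rw [cutPow, Real.smoothTransition.zero_of_nonpos, zero_mul]
      rw [sub_nonpos, div_le_one hδ]
      exact hy.le
    exact contDiffAt_const.congr_of_eventuallyEq this
  · have hr0 : r ≠ 0 := (hδ.trans_le hr).ne'
    have h1 : ContDiffAt ℝ 1 (fun y : ℝ => y / δ - 1) r := by fun_prop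
    exact (Real.smoothTransition.contDiffAt.comp r h1).mul (Real.contDiffAt_rpow_const_of_ne hr0)

theorem exists_bound_deriv_smoothTransition :
    ∃ M : ℝ, 0 ≤ M ∧ ∀ x, |deriv Real.smoothTransition x| ≤ M ∧
      (1 < x → deriv Real.smoothTransition x = 0) := by
  have h1 : ∀ x : ℝ, 1 < x → deriv Real.smoothTransition x = 0 := fun x hx => by
    have : Real.smoothTransition =ᶠ[𝓝 x] fun _ => 1 := by
      filter_upwards [lt_mem_nhds hx] with y hy using Real.smoothTransition.one_of_one_le hy.le
    rw [this.deriv_eq, deriv_const]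
  have h0 : ∀ x : ℝ, x < 0 → deriv Real.smoothTransition x = 0 := fun x hx => by
    have : Real.smoothTransition =ᶠ[𝓝 x] fun _ => 0 := by
      filter_upwards [gt_mem_nhds hx] with y hy using Real.smoothTransition.zero_of_nonpos hy.le
    rw [this.deriv_eq, deriv_const]
  obtain ⟨M, hM⟩ := (isCompact_Icc (a := (0 : ℝ)) (b := 1)).exists_bound_of_continuousOn
    ((Real.smoothTransition.contDiff (n := 1)).continuous_deriv le_rfl).continuousOn
  have hM0 : 0 ≤ M := (norm_nonneg _).trans (hM 0 (by simp))
  refine ⟨M, hM0, fun x => ⟨?_, h1 x⟩⟩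
  by_cases hx : x ∈ Set.Icc (0 : ℝ) 1
  · exact hM x hx
  · rw [Set.mem_Icc, not_and_or, not_le, not_le] at hx
    rcases hx with hx | hx
    · simp [h0 x hx, hM0]
    · simp [h1 x hx, hM0]

/-- The bound is uniform in `δ`: the cutoff has slope of order `1/δ`, but only where `r ≤ 2δ`, and
there `1/δ ≤ 2/r`. -/
theorem exists_bound_deriv_cutPow (a : ℝ) :
    ∃ c : ℝ, 0 ≤ c ∧ ∀ δ r : ℝ, 0 < δ → 0 < r →
      |deriv (cutPow a δ) r| ≤ c * r ^ (-a / 2 - 1) := by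
  obtain ⟨M, hM0, hM⟩ := exists_bound_deriv_smoothTransition
  refine ⟨2 * M + |-a / 2|, by positivity, fun δ r hδ hr => ?_⟩
  have h1 : HasDerivAt (fun y : ℝ => y / δ - 1) (1 / δ) r :=
    ((hasDerivAt_id r).div_const δ).sub_const 1
  have h2 : HasDerivAt (fun y => Real.smoothTransition (y / δ - 1))
      (deriv Real.smoothTransition (r / δ - 1) * (1 / δ)) r :=
    HasDerivAt.comp (h := fun y : ℝ => y / δ - 1) r
      (((Real.smoothTransition.contDiff (n := 1)).differentiable one_ne_zero _).hasDerivAt) h1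
  have h3 := h2.mul (Real.hasDerivAt_rpow_const (p := -a / 2) (Or.inl hr.ne'))
  have h4 : deriv (cutPow a δ) r = _ := h3.deriv
  rw [h4]
  have h5 : |deriv Real.smoothTransition (r / δ - 1) * (1 / δ)| ≤ 2 * M * r⁻¹ := by
    rw [abs_mul, abs_of_pos (by positivity : 0 < 1 / δ)]
    by_cases hc : 1 < r / δ - 1
    · rw [(hM _).2 hc]; simp; positivity
    · have h6 : r ≤ 2 * δ := by
        have : r / δ ≤ 2 := by linarith
        rwa [div_le_iff₀ hδ] at this
      have h7 : 1 / δ ≤ 2 * r⁻¹ := by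
        rw [← div_eq_mul_inv, div_le_div_iff₀ hδ hr]; linarith
      calc _ ≤ M * (2 * r⁻¹) := mul_le_mul (hM _).1 h7 (by positivity) hM0
        _ = _ := by ring
  have h8 : |Real.smoothTransition (r / δ - 1)| ≤ 1 := by
    rw [abs_of_nonneg (Real.smoothTransition.nonneg _)]
    exact Real.smoothTransition.le_one _
  have hr1 : r ^ (-a / 2) = r * r ^ (-a / 2 - 1) := by
    rw [Real.rpow_sub_one hr.ne']; field_simp
  calc _ ≤ |deriv Real.smoothTransition (r / δ - 1) * (1 / δ)| * r ^ (-a / 2) +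
        |Real.smoothTransition (r / δ - 1)| * (|-a / 2| * r ^ (-a / 2 - 1)) := by
        refine (abs_add_le _ _).trans (le_of_eq ?_)
        rw [abs_mul _ (r ^ (-a / 2)), abs_mul _ (-a / 2 * r ^ (-a / 2 - 1)), abs_mul (-a / 2),
          abs_of_pos (Real.rpow_pos_of_pos hr _), abs_of_pos (Real.rpow_pos_of_pos hr (-a / 2 - 1))]
    _ ≤ 2 * M * r⁻¹ * r ^ (-a / 2) + 1 * (|-a / 2| * r ^ (-a / 2 - 1)) := by gcongr
    _ = _ := by rw [hr1]; field_simp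

theorem norm_cutPow_le (hr : 0 < r) : |cutPow a δ r| ≤ r ^ (-a / 2) := by
  rw [cutPow, abs_mul, abs_of_pos (Real.rpow_pos_of_pos hr _),
    abs_of_nonneg (Real.smoothTransition.nonneg _)]
  exact mul_le_of_le_one_left (by positivity) (Real.smoothTransition.le_one _)

theorem cutPow_of_two_mul_le (hδ : 0 < δ) (h : 2 * δ ≤ r) : cutPow a δ r = r ^ (-a / 2) := by
  rw [cutPow, Real.smoothTransition.one_of_one_le, one_mul]
  have : 2 ≤ r / δ := by rwa [le_div_iff₀ hδ]
  linarith

end Cutoff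

/-! ### Caffarelli-Kohn-Nirenberg for compactly supported functions -/

section CKN

variable {N : ℕ}

theorem rpow_norm_sq {F : Type*} [NormedAddCommGroup F] (x : F) (c : ℝ) :
    (‖x‖ ^ 2) ^ (c / 2) = ‖x‖ ^ c := by
  rw [← Real.rpow_natCast, ← Real.rpow_mul (norm_nonneg _)]
  congr 1
  push_cast
  ring

/-- Composing with the smooth function `‖y‖ ^ 2` turns the power `-a/2` into `|y|^{-a}`.
Differentiating the cutoff and the power costs a factor `1/|x|`, which is exactly the Hardy weight.
-/
theorem exists_bound_fderiv_cutPow_mul (a : ℝ) :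
    ∃ c : ℝ≥0∞, c ≠ ⊤ ∧ ∀ φ : Euc N → ℝ, ContDiff ℝ 1 φ → ∀ δ : ℝ, 0 < δ → ∀ x : Euc N, x ≠ 0 →
      ‖fderiv ℝ (fun y => cutPow a δ (‖y‖ ^ 2) * φ y) x‖ₑ ^ 2 ≤
        c * (ENNReal.ofReal (‖x‖ ^ (-(2 * a) - 2)) * ‖φ x‖ₑ ^ 2) +
        2 * (ENNReal.ofReal (‖x‖ ^ (-(2 * a))) * ‖gradient φ x‖ₑ ^ 2) := by
  obtain ⟨c, hc0, hc⟩ := exists_bound_deriv_cutPow a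
  refine ⟨ENNReal.ofReal (2 * (2 * c) ^ 2), ENNReal.ofReal_ne_top, fun φ hφ δ hδ x hx => ?_⟩
  have hx0 : 0 < ‖x‖ := norm_pos_iff.2 hx
  have h1 : HasFDerivAt (fun y : Euc N => ‖y‖ ^ 2) (2 • (innerSL ℝ x)) x :=
    (hasStrictFDerivAt_norm_sq x).hasFDerivAt
  have h2 : HasFDerivAt (fun y : Euc N => cutPow a δ (‖y‖ ^ 2))
      (deriv (cutPow a δ) (‖x‖ ^ 2) • (2 • (innerSL ℝ x))) x :=
    (((contDiff_cutPow hδ).differentiable one_ne_zero _).hasDerivAt).comp_hasFDerivAt x h1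
  have h3 := h2.mul ((hφ.differentiable one_ne_zero x).hasFDerivAt)
  have h3' : fderiv ℝ (fun y => cutPow a δ (‖y‖ ^ 2) * φ y) x = _ := h3.fderiv
  rw [h3']
  have h4 : ‖cutPow a δ (‖x‖ ^ 2) • fderiv ℝ φ x +
      φ x • deriv (cutPow a δ) (‖x‖ ^ 2) • (2 • innerSL ℝ x)‖ ≤
      ‖x‖ ^ (-a) * ‖gradient φ x‖ + 2 * c * ‖x‖ ^ (-a - 1) * ‖φ x‖ := by
    have h5 : ‖fderiv ℝ φ x‖ = ‖gradient φ x‖ := by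
      rw [gradient, LinearIsometryEquiv.norm_map]
    refine (norm_add_le _ _).trans (add_le_add ?_ ?_)
    · rw [norm_smul, h5]
      gcongr
      refine (norm_cutPow_le (by positivity)).trans (le_of_eq (rpow_norm_sq x _))
    · rw [norm_smul, norm_smul, ← Nat.cast_smul_eq_nsmul ℝ, norm_smul, innerSL_apply_norm]
      have h6 := hc δ (‖x‖ ^ 2) hδ (by positivity)
      rw [show -a / 2 - 1 = (-a - 2) / 2 by ring, rpow_norm_sq] at h6
      have h7 : ‖x‖ ^ (-a - 1) = ‖x‖ ^ (-a - 2) * ‖x‖ := by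
        rw [← Real.rpow_add_one hx0.ne']; ring_nf
      rw [h7]
      calc _ ≤ ‖φ x‖ * (c * ‖x‖ ^ (-a - 2) * (‖((2 : ℕ) : ℝ)‖ * ‖x‖)) := by
            gcongr
            exact h6
        _ = _ := by norm_num; ring
  have h8 : ‖cutPow a δ (‖x‖ ^ 2) • fderiv ℝ φ x +
      φ x • deriv (cutPow a δ) (‖x‖ ^ 2) • (2 • innerSL ℝ x)‖ ^ 2 ≤
      2 * (2 * c) ^ 2 * (‖x‖ ^ (-(2 * a) - 2) * ‖φ x‖ ^ 2) +
        2 * (‖x‖ ^ (-(2 * a)) * ‖gradient φ x‖ ^ 2) := by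
    have e1 : ‖x‖ ^ (-(2 * a)) = (‖x‖ ^ (-a)) ^ 2 := by
      rw [← Real.rpow_natCast, ← Real.rpow_mul hx0.le]; push_cast; ring_nf
    have e2 : ‖x‖ ^ (-(2 * a) - 2) = (‖x‖ ^ (-a - 1)) ^ 2 := by
      rw [← Real.rpow_natCast, ← Real.rpow_mul hx0.le]; push_cast; ring_nf
    refine (pow_le_pow_left₀ (norm_nonneg _) h4 2).trans ?_
    rw [e1, e2]
    nlinarith [sq_nonneg (‖x‖ ^ (-a) * ‖gradient φ x‖ - 2 * c * ‖x‖ ^ (-a - 1) * ‖φ x‖)]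
  have hk : 0 ≤ 2 * (2 * c) ^ 2 := by positivity
  generalize 2 * (2 * c) ^ 2 = k at h8 hk ⊢
  have h9 := ENNReal.ofReal_le_ofReal h8
  rw [ENNReal.ofReal_add (by positivity) (by positivity), ENNReal.ofReal_mul (by positivity),
    ENNReal.ofReal_mul (by positivity), ENNReal.ofReal_mul (p := 2) (by positivity),
    ENNReal.ofReal_mul (by positivity), ENNReal.ofReal_pow (norm_nonneg _),
    ENNReal.ofReal_pow (norm_nonneg _), ENNReal.ofReal_pow (norm_nonneg _), ofReal_norm,
    ofReal_norm, ofReal_norm] at h9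
  simpa using h9

/-- This is the endpoint `b = a`. Sobolev's inequality is applied to `|x|^{-a} φ` cut off near the
origin, Hardy's inequality controls the derivative of the weight, and Fatou's lemma removes the
cutoff. -/
theorem exists_weighted_sobolev_const (hN : 3 ≤ N) {a α q : ℝ} (hα : 0 < α)
    (hs : 2 * α = N + (-(2 * a) - 2)) (hq : q = 2 * N / (N - 2)) :
    ∃ C : ℝ≥0∞, C ≠ ⊤ ∧ ∀ φ : Euc N → ℝ, ContDiff ℝ 1 φ → HasCompactSupport φ →
      ∫⁻ x, ‖φ x‖ₑ ^ q ∂powMeasure N (-(a * q)) ≤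
        C * (∫⁻ x, ‖gradient φ x‖ₑ ^ 2 ∂powMeasure N (-(2 * a))) ^ (q / 2) := by
  have : NeZero N := ⟨by omega⟩
  have hN' : (3 : ℝ) ≤ N := by exact_mod_cast hN
  have hq0 : 0 < q := by rw [hq]; apply div_pos <;> linarith
  obtain ⟨C, hC, hsob⟩ := exists_sobolev_const hN hq
  obtain ⟨c, hc, hgrad⟩ := exists_bound_fderiv_cutPow_mul (N := N) a
  refine ⟨C * (c * ENNReal.ofReal α⁻¹ ^ 2 + 2) ^ (q / 2), ENNReal.mul_ne_top hC
    (ENNReal.rpow_ne_top_of_nonneg (by positivity) (ENNReal.add_ne_top.2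
      ⟨ENNReal.mul_ne_top hc (by simp), by simp⟩)), fun φ hφ hφc => ?_⟩
  set I := ∫⁻ x, ‖gradient φ x‖ₑ ^ 2 ∂powMeasure N (-(2 * a)) with hI
  have hardy' := hardy hα hs hφ hφc
  rw [sub_add_cancel, ← hI] at hardy'
  let δ : ℕ → ℝ := fun n => 1 / ((n : ℝ) + 1)
  have hδ : ∀ n, 0 < δ n := fun n => Nat.one_div_pos_of_nat
  let v : ℕ → Euc N → ℝ := fun n y => cutPow a (δ n) (‖y‖ ^ 2) * φ y
  have hvc : ∀ n, ContDiff ℝ 1 (v n) := fun n =>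
    ((contDiff_cutPow (hδ n)).comp (contDiff_norm_sq ℝ)).mul hφ
  have hgm : Measurable (gradient φ) := (continuous_gradient hφ).measurable
  have hφm : Measurable φ := hφ.continuous.measurable
  have hbound : ∀ n, ∫⁻ x, ‖v n x‖ₑ ^ q ≤
      C * (c * ENNReal.ofReal α⁻¹ ^ 2 + 2) ^ (q / 2) * I ^ (q / 2) := by
    intro n
    refine (hsob (v n) (hvc n) hφc.mul_left).trans ?_
    rw [mul_assoc, ← ENNReal.mul_rpow_of_nonneg _ _ (by positivity)]
    gcongr
    calc ∫⁻ x, ‖fderiv ℝ (v n) x‖ₑ ^ 2 ≤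
        ∫⁻ x, (c * (ENNReal.ofReal (‖x‖ ^ (-(2 * a) - 2)) * ‖φ x‖ₑ ^ 2) +
          2 * (ENNReal.ofReal (‖x‖ ^ (-(2 * a))) * ‖gradient φ x‖ₑ ^ 2)) :=
          lintegral_mono_ae (ae_ne_zero_euc.mono (hgrad φ hφ (δ n) (hδ n)))
      _ = c * ∫⁻ x, ‖φ x‖ₑ ^ 2 ∂powMeasure N (-(2 * a) - 2) + 2 * I := by
          rw [lintegral_add_left (by fun_prop), lintegral_const_mul' _ _ hc,
            lintegral_const_mul' _ _ (by simp), hI, lintegral_powMeasure, lintegral_powMeasure]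
      _ ≤ c * (ENNReal.ofReal α⁻¹ ^ 2 * I) + 2 * I := by gcongr
      _ = _ := by ring
  have hlim : ∀ x : Euc N, x ≠ 0 → Tendsto (fun n => ‖v n x‖ₑ ^ q) atTop
      (𝓝 (ENNReal.ofReal (‖x‖ ^ (-(a * q))) * ‖φ x‖ₑ ^ q)) := by
    intro x hx
    have hx0 : 0 < ‖x‖ := norm_pos_iff.2 hx
    refine tendsto_const_nhds.congr' ?_
    have h1 : Tendsto (fun n => 2 * δ n) atTop (𝓝 0) := by
      simpa [δ] using tendsto_one_div_add_atTop_nhds_zero_nat.const_mul (2 : ℝ)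
    filter_upwards [h1.eventually_lt_const (by positivity : (0 : ℝ) < ‖x‖ ^ 2)] with n hn
    simp only [v]
    rw [cutPow_of_two_mul_le (hδ n) hn.le, rpow_norm_sq, enorm_mul,
      ENNReal.mul_rpow_of_nonneg _ _ hq0.le, Real.enorm_of_nonneg (r := ‖x‖ ^ (-a)) (by positivity),
      ENNReal.ofReal_rpow_of_pos (by positivity), ← Real.rpow_mul hx0.le, neg_mul]
  rw [lintegral_powMeasure]
  calc _ ≤ ∫⁻ x, liminf (fun n => ‖v n x‖ₑ ^ q) atTop :=
        lintegral_mono_ae (ae_ne_zero_euc.mono fun x hx => (hlim x hx).liminf_eq.ge)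
    _ ≤ liminf (fun n => ∫⁻ x, ‖v n x‖ₑ ^ q) atTop :=
        lintegral_liminf_le fun n => (hvc n).continuous.measurable.enorm.pow_const q
    _ ≤ liminf (fun _ : ℕ => C * (c * ENNReal.ofReal α⁻¹ ^ 2 + 2) ^ (q / 2) * I ^ (q / 2)) atTop :=
        liminf_le_liminf (Eventually.of_forall hbound)
    _ = _ := by simp

/-- The Caffarelli-Kohn-Nirenberg inequality for functions of class `C^1` with compact support. -/
theorem exists_ckn_const_of_contDiff (hN : 3 ≤ N) {a b p : ℝ} (ha : a < ((N : ℝ) - 2) / 2)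
    (hab : a ≤ b) (hba : b < a + 1) (hp : p = 2 * (N : ℝ) / ((N : ℝ) - 2 * (1 + a - b))) :
    ∃ C : ℝ≥0∞, C ≠ ⊤ ∧ ∀ φ : Euc N → ℝ, ContDiff ℝ 1 φ → HasCompactSupport φ →
      ∫⁻ x, ‖φ x‖ₑ ^ p ∂powMeasure N (-(b * p)) ≤
        C * (∫⁻ x, ‖gradient φ x‖ₑ ^ 2 ∂powMeasure N (-(2 * a))) ^ (p / 2) := by
  have : NeZero N := ⟨by omega⟩
  have hN' : (3 : ℝ) ≤ N := by exact_mod_cast hN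
  set q : ℝ := 2 * N / (N - 2) with hq
  set α : ℝ := (N - 2 - 2 * a) / 2 with hαdef
  have hα : 0 < α := by rw [hαdef]; linarith
  have hs : 2 * α = N + (-(2 * a) - 2) := by rw [hαdef]; ring
  have hq0 : 0 < q := by rw [hq]; apply div_pos <;> linarith
  have hp0 : 0 < p := by rw [hp]; apply div_pos <;> linarith
  obtain ⟨C, hC, hsob⟩ := exists_weighted_sobolev_const hN hα hs hq
  -- Hölder exponents interpolating between Hardy's inequality (endpoint `b = a + 1`, power `2`) and
  -- the weighted Sobolev inequality (endpoint `b = a`, power `q`). That `A + B = 1` is precisely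
  -- the formula for `p`.
  set A : ℝ := (b - a) * p / 2 with hA
  set B : ℝ := (1 - (b - a)) * p / q with hB
  have hA0 : 0 ≤ A := by rw [hA]; have := sub_nonneg.2 hab; positivity
  have hB0 : 0 ≤ B := by
    rw [hB]; have : 0 ≤ 1 - (b - a) := by linarith
    positivity
  have hAB : A + B = 1 := by
    rw [hA, hB, hq, hp]
    have h1 : (N : ℝ) - 2 * (1 + a - b) ≠ 0 := by linarith
    have h2 : (N : ℝ) - 2 ≠ 0 := by linarith
    field_simp
    ring
  have hBq : q * B = (1 - (b - a)) * p := by rw [hB]; field_simp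
  refine ⟨(ENNReal.ofReal α⁻¹ ^ 2) ^ A * C ^ B, ENNReal.mul_ne_top
    (ENNReal.rpow_ne_top_of_nonneg hA0 (by simp)) (ENNReal.rpow_ne_top_of_nonneg hB0 hC),
    fun φ hφ hφc => ?_⟩
  set I := ∫⁻ x, ‖gradient φ x‖ₑ ^ 2 ∂powMeasure N (-(2 * a)) with hI
  have hardy' := hardy hα hs hφ hφc
  rw [sub_add_cancel, ← hI] at hardy'
  have hφm : Measurable φ := hφ.continuous.measurable
  calc ∫⁻ x, ‖φ x‖ₑ ^ p ∂powMeasure N (-(b * p))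
      = ∫⁻ x, (ENNReal.ofReal (‖x‖ ^ (-(2 * a) - 2)) * ‖φ x‖ₑ ^ 2) ^ A *
          (ENNReal.ofReal (‖x‖ ^ (-(a * q))) * ‖φ x‖ₑ ^ q) ^ B := by
        rw [lintegral_powMeasure]
        refine lintegral_congr_ae (ae_ne_zero_euc.mono fun x hx => ?_)
        have hx0 : 0 < ‖x‖ := norm_pos_iff.2 hx
        simp only
        rw [ENNReal.mul_rpow_of_nonneg _ _ hA0, ENNReal.mul_rpow_of_nonneg _ _ hB0,
          ENNReal.ofReal_rpow_of_pos (by positivity), ENNReal.ofReal_rpow_of_pos (by positivity),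
          ← Real.rpow_mul hx0.le, ← Real.rpow_mul hx0.le, mul_mul_mul_comm,
          ← ENNReal.ofReal_mul (by positivity), ← Real.rpow_add hx0, ← ENNReal.rpow_mul,
          ← ENNReal.rpow_natCast, ← ENNReal.rpow_mul,
          ← ENNReal.rpow_add_of_nonneg _ _ (by positivity) (by positivity), hBq]
        have e1 : (-(2 * a) - 2) * A + -(a * q) * B = -(b * p) := by
          rw [neg_mul, mul_assoc, hBq, hA]; ring
        have e2 : ((2 : ℕ) : ℝ) * A + (1 - (b - a)) * p = p := by
          rw [hA]; push_cast; ring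
        rw [e1, e2]
    _ ≤ (∫⁻ x, ENNReal.ofReal (‖x‖ ^ (-(2 * a) - 2)) * ‖φ x‖ₑ ^ 2) ^ A *
          (∫⁻ x, ENNReal.ofReal (‖x‖ ^ (-(a * q))) * ‖φ x‖ₑ ^ q) ^ B :=
        ENNReal.lintegral_mul_norm_pow_le (by fun_prop) (by fun_prop) hA0 hB0 hAB
    _ ≤ (ENNReal.ofReal α⁻¹ ^ 2 * I) ^ A * (C * I ^ (q / 2)) ^ B := by
        rw [← lintegral_powMeasure, ← lintegral_powMeasure]
        gcongr
        exact hsob φ hφ hφc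
    _ = _ := by
        rw [ENNReal.mul_rpow_of_nonneg _ _ hA0, ENNReal.mul_rpow_of_nonneg _ _ hB0,
          mul_mul_mul_comm, ← ENNReal.rpow_mul,
          ← ENNReal.rpow_add_of_nonneg _ _ hA0 (by positivity)]
        congr 2
        rw [div_mul_eq_mul_div, hBq, hA]
        ring

end CKN

/-! ### Test functions: dilation and integrability -/

section TestFunctions

variable {N : ℕ} {φ ψ : Euc N → ℝ}

theorem IsTestFunction.contDiff_one (h : IsTestFunction φ) : ContDiff ℝ 1 φ :=
  h.1.of_le (by exact_mod_cast le_top)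

theorem IsTestFunction.sub (hφ : IsTestFunction φ) (hψ : IsTestFunction ψ) :
    IsTestFunction (φ - ψ) :=
  ⟨hφ.1.sub hψ.1, hφ.2.sub hψ.2⟩

theorem gradient_sub_apply (hφ : ContDiff ℝ 1 φ) (hψ : ContDiff ℝ 1 ψ) (x : Euc N) :
    gradient (φ - ψ) x = gradient φ x - gradient ψ x := by
  simp only [gradient]
  rw [fderiv_sub (hφ.differentiable one_ne_zero x) (hψ.differentiable one_ne_zero x), map_sub]

theorem IsTestFunction.dil (hφ : IsTestFunction φ) (κ t : ℝ) : IsTestFunction (dil κ t φ) := by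
  constructor
  · have : ContDiff ℝ ∞ fun x : Euc N => Real.exp t • x := contDiff_const_smul _
    exact contDiff_const.mul (hφ.1.comp this)
  · have := hφ.2.comp_homeomorph (Homeomorph.smulOfNeZero (Real.exp t) (Real.exp_ne_zero t))
    exact this.mul_left (f := fun _ => Real.exp (κ * t))

theorem gradient_dil (hφ : ContDiff ℝ 1 φ) (κ t : ℝ) (x : Euc N) :
    gradient (dil κ t φ) x = dil (κ + 1) t (gradient φ) x := by
  have h1 : HasFDerivAt (fun y : Euc N => Real.exp t • y)
      (Real.exp t • ContinuousLinearMap.id ℝ (Euc N)) x :=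
    (hasFDerivAt_id x).const_smul (Real.exp t)
  have h2 := ((hφ.differentiable one_ne_zero (Real.exp t • x)).hasFDerivAt.comp x h1).const_smul
    (Real.exp (κ * t))
  have h3 : fderiv ℝ (_root_.dil κ t φ) x = _ := h2.fderiv
  simp only [gradient, _root_.dil]
  rw [h3, ContinuousLinearMap.comp_smul, ContinuousLinearMap.comp_id, map_smul, map_smul, smul_smul,
    ← Real.exp_add]
  ring_nf

/-- The weight is locally integrable because `s > -N`. This gives test functions finite energy. -/
theorem lintegral_sq_powMeasure_lt_top [NeZero N] {s : ℝ} (hs : -(N : ℝ) < s) {F : Type*}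
    [NormedAddCommGroup F] {f : Euc N → F} (hf : Continuous f) (hc : HasCompactSupport f) :
    ∫⁻ x, ‖f x‖ₑ ^ 2 ∂powMeasure N s < ⊤ := by
  obtain ⟨R, hR⟩ := hc.isCompact.isBounded.subset_ball 0
  obtain ⟨M, hM⟩ := hf.bounded_above_of_compact_support hc
  have hN : 1 ≤ Module.finrank ℝ (Euc N) := by
    simpa using Nat.one_le_iff_ne_zero.2 (NeZero.ne N)
  have h1 : IntegrableOn (fun x : Euc N => ‖x‖ ^ s * ‖f x‖ ^ 2) (Metric.ball 0 R) := by
    refine integrableOn_ball_of_norm_le_rpow (μ := volume) (C := M ^ 2) (α := -s) hN ?_ ?_ ?_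
    · simpa using neg_lt.1 hs
    · refine Eventually.of_forall fun x => ?_
      rw [norm_mul, Real.norm_of_nonneg (Real.rpow_nonneg (norm_nonneg _) _),
        Real.norm_of_nonneg (by positivity), mul_comm, neg_neg]
      gcongr
      exact hM x
    · exact ((by fun_prop : Measurable fun x : Euc N => ‖x‖ ^ s).mul
        (hf.norm.pow 2).measurable).aestronglyMeasurable
  have h2 := h1.hasFiniteIntegral
  rw [hasFiniteIntegral_iff_enorm] at h2
  rw [lintegral_powMeasure]
  refine lt_of_le_of_lt (le_of_eq ?_) h2
  rw [← lintegral_indicator measurableSet_ball]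
  refine lintegral_congr fun x => ?_
  by_cases hx : x ∈ Metric.ball (0 : Euc N) R
  · rw [Set.indicator_of_mem hx, enorm_mul, enorm_pow, enorm_norm,
      Real.enorm_of_nonneg (Real.rpow_nonneg (norm_nonneg _) _)]
  · rw [Set.indicator_of_notMem hx, image_eq_zero_of_notMem_tsupport fun h => hx (hR h)]
    simp

theorem IsTestFunction.continuous_gradient (hφ : IsTestFunction φ) : Continuous (gradient φ) :=
  _root_.continuous_gradient hφ.contDiff_one

theorem IsTestFunction.hasCompactSupport_gradient (hφ : IsTestFunction φ) :
    HasCompactSupport (gradient φ) :=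
  (hφ.2.fderiv (𝕜 := ℝ)).comp_left (map_zero (InnerProductSpace.toDual ℝ (Euc N)).symm)

end TestFunctions

/-! ### The completion `D^{1,2}_a`: stability under dilations and passage to the limit -/

section Energy

variable {N : ℕ} {a : ℝ} {u v : Euc N → ℝ} {G H : Euc N → Euc N}

/-- The squared norm of `D^{1,2}_a`, in terms of the gradient. -/
noncomputable def energy (a : ℝ) (G : Euc N → Euc N) : ℝ≥0∞ :=
  ∫⁻ x, ‖G x‖ₑ ^ 2 ∂powMeasure N (-(2 * a))

theorem energy_sub_le (hG : AEStronglyMeasurable G volume) (H : Euc N → Euc N) :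
    energy a (G - H) ≤ 2 * (energy a G + energy a H) := by
  unfold energy
  rw [← lintegral_add_left'
    ((aestronglyMeasurable_powMeasure hG).enorm.pow_const 2), ← lintegral_const_mul' _ _ (by simp)]
  refine lintegral_mono fun x => ?_
  simpa [sub_eq_add_neg] using enorm_add_sq_le (G x) (-H x)

theorem energy_sub_comm (G H : Euc N → Euc N) : energy a (G - H) = energy a (H - G) := by
  unfold energy
  refine lintegral_congr fun x => ?_
  rw [Pi.sub_apply, Pi.sub_apply, ← neg_sub, enorm_neg]

theorem energy_dil {κ : ℝ} (hκ : 2 * κ = N + -(2 * a)) (t : ℝ) (G : Euc N → Euc N) :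
    energy a (dil κ t G) = energy a G :=
  lintegral_enorm_dil_sq hκ t G

theorem energy_congr [NeZero N] (h : G =ᵐ[volume] H) : energy a G = energy a H :=
  lintegral_congr_ae ((ae_powMeasure_iff.2 h).mono fun x hx => by
    simp only [hx])

theorem lintegral_ofReal_rpow_mul_sq (G : Euc N → Euc N) :
    ∫⁻ x, ENNReal.ofReal (‖x‖ ^ (-(2 * a)) * ‖G x‖ ^ 2) = energy a G := by
  unfold energy
  rw [lintegral_powMeasure]
  refine lintegral_congr fun x => ?_
  rw [ENNReal.ofReal_mul (Real.rpow_nonneg (norm_nonneg _) _), ENNReal.ofReal_pow (norm_nonneg _),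
    ofReal_norm]

theorem hasGradientInD_iff : HasGradientInD a u G ↔ AEStronglyMeasurable G volume ∧
    ∃ φ : ℕ → Euc N → ℝ, (∀ n, IsTestFunction (φ n)) ∧
      (∀ᵐ x, Tendsto (fun n => φ n x) atTop (𝓝 (u x))) ∧
      Tendsto (fun n => energy a (gradient (φ n) - G)) atTop (𝓝 0) := by
  simp only [HasGradientInD, ← lintegral_ofReal_rpow_mul_sq, Pi.sub_apply]

theorem IsTestFunction.hasGradientInD (hu : IsTestFunction u) :
    HasGradientInD a u (gradient u) :=
  hasGradientInD_iff.2 ⟨hu.continuous_gradient.aestronglyMeasurable, fun _ => u, fun _ => hu,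
    Eventually.of_forall fun _ => tendsto_const_nhds, by simp [energy]⟩

theorem HasGradientInD.aestronglyMeasurable (h : HasGradientInD a u G) :
    AEStronglyMeasurable u volume := by
  obtain ⟨_, φ, hφ, hlim, _⟩ := h
  exact aestronglyMeasurable_of_tendsto_ae atTop
    (fun n => (hφ n).contDiff_one.continuous.aestronglyMeasurable) hlim

theorem HasGradientInD.congr [NeZero N] (h : HasGradientInD a u G) (huv : u =ᵐ[volume] v)
    (hGH : G =ᵐ[volume] H) : HasGradientInD a v H := by
  obtain ⟨hG, φ, hφ, hlim, hE⟩ := hasGradientInD_iff.1 h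
  refine hasGradientInD_iff.2 ⟨hG.congr hGH, φ, hφ, ?_, ?_⟩
  · filter_upwards [hlim, huv] with x hx h1
    rwa [← h1]
  · refine hE.congr fun n => energy_congr ?_
    filter_upwards [hGH] with x hx
    simp [hx]

theorem HasGradientInD.sub (hu : HasGradientInD a u G) (hv : HasGradientInD a v H) :
    HasGradientInD a (u - v) (G - H) := by
  obtain ⟨hG, φ, hφ, hlim, hE⟩ := hasGradientInD_iff.1 hu
  obtain ⟨hH, ψ, hψ, hlim', hE'⟩ := hasGradientInD_iff.1 hv
  refine hasGradientInD_iff.2 ⟨hG.sub hH, fun n => φ n - ψ n, fun n => (hφ n).sub (hψ n), ?_, ?_⟩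
  · filter_upwards [hlim, hlim'] with x h1 h2 using h1.sub h2
  · have h0 : Tendsto (fun n => 2 * (energy a (gradient (φ n) - G) +
        energy a (gradient (ψ n) - H))) atTop (𝓝 0) := by
      simpa using ENNReal.Tendsto.const_mul (hE.add hE') (Or.inr (by simp : (2 : ℝ≥0∞) ≠ ⊤))
    refine tendsto_of_tendsto_of_tendsto_of_le_of_le tendsto_const_nhds h0
      (fun _ => zero_le) fun n => ?_
    have h1 : gradient (φ n - ψ n) - (G - H) = (gradient (φ n) - G) - (gradient (ψ n) - H) := by
      ext1 x
      simp only [Pi.sub_apply, gradient_sub_apply (hφ n).contDiff_one (hψ n).contDiff_one]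
      abel
    simp only [h1]
    exact energy_sub_le ((hφ n).continuous_gradient.aestronglyMeasurable.sub hG) _

/-- Differentiating the dilated argument gains a factor `e^t`, hence the amplitude `α + 1` for
gradients; the hypothesis makes it an isometry for the energy. -/
theorem HasGradientInD.dil {α : ℝ} (hα : 2 * (α + 1) = N + -(2 * a)) (hu : HasGradientInD a u G)
    (t : ℝ) : HasGradientInD a (dil α t u) (dil (α + 1) t G) := by
  obtain ⟨hG, φ, hφ, hlim, hE⟩ := hasGradientInD_iff.1 hu
  refine hasGradientInD_iff.2 ⟨aestronglyMeasurable_dil hG _ _, fun n => _root_.dil α t (φ n),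
    fun n => (hφ n).dil _ _, ?_, ?_⟩
  · filter_upwards [(quasiMeasurePreserving_exp_smul t).ae hlim] with x hx
    exact hx.const_smul _
  · refine hE.congr fun n => ?_
    rw [← energy_dil hα t, dil_sub]
    congr 2
    ext1 x
    exact (gradient_dil (hφ n).contDiff_one α t x).symm

/-- The energies of an approximating sequence are controlled by the energy of the limit. -/
theorem energy_gradient_le (hG : AEStronglyMeasurable G volume) {φ : Euc N → ℝ}
    (hφ : IsTestFunction φ) :
    energy a (gradient φ) ≤ 2 * (energy a (gradient φ - G) + energy a G) := by
  have h := energy_sub_le (a := a) (hφ.continuous_gradient.aestronglyMeasurable.sub hG) (-G)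
  have h2 : energy a (-G) = energy a G := by simp [energy]
  rwa [h2, sub_neg_eq_add, sub_add_cancel] at h

theorem energy_gradient_lt_top [NeZero N] (ha : 2 * a < N) {φ : Euc N → ℝ}
    (hφ : IsTestFunction φ) : energy a (gradient φ) < ⊤ :=
  lintegral_sq_powMeasure_lt_top (by linarith) hφ.continuous_gradient hφ.hasCompactSupport_gradient

theorem HasGradientInD.energy_lt_top [NeZero N] (ha : 2 * a < N) (hu : HasGradientInD a u G) :
    energy a G < ⊤ := by
  obtain ⟨hG, φ, hφ, hlim, hE⟩ := hasGradientInD_iff.1 hu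
  obtain ⟨n, hn⟩ := (hE.eventually_lt_const (by simp : (0 : ℝ≥0∞) < 1)).exists
  have h := energy_sub_le (a := a) (hφ n).continuous_gradient.aestronglyMeasurable
    (gradient (φ n) - G)
  rw [sub_sub_cancel] at h
  exact h.trans_lt (ENNReal.mul_lt_top (by simp)
    (ENNReal.add_lt_top.2 ⟨energy_gradient_lt_top ha (hφ n), hn.trans (by simp)⟩))

/-- A bound by the energy for test functions passes to the completion, by Fatou's lemma. -/
theorem HasGradientInD.lintegral_le_of_test [NeZero N] {s : ℝ} {T : (Euc N → ℝ) → Euc N → ℝ≥0∞}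
    {B : ℝ≥0∞ → ℝ≥0∞} (hB : Continuous B) (hBm : Monotone B) (hu : HasGradientInD a u G)
    (hTm : ∀ φ : Euc N → ℝ, IsTestFunction φ → Measurable (T φ))
    (hT : ∀ φ : ℕ → Euc N → ℝ, (∀ᵐ x, Tendsto (fun n => φ n x) atTop (𝓝 (u x))) →
      ∀ᵐ x, Tendsto (fun n => T (φ n) x) atTop (𝓝 (T u x)))
    (h : ∀ φ : Euc N → ℝ, IsTestFunction φ →
      ∫⁻ x, T φ x ∂powMeasure N s ≤ B (energy a (gradient φ))) :
    ∫⁻ x, T u x ∂powMeasure N s ≤ B (2 * energy a G) := by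
  obtain ⟨hG, φ, hφ, hlim, hE⟩ := hasGradientInD_iff.1 hu
  have h0 : Tendsto (fun n => B (2 * (energy a (gradient (φ n) - G) + energy a G))) atTop
      (𝓝 (B (2 * energy a G))) := by
    refine (hB.tendsto _).comp ?_
    simpa using ENNReal.Tendsto.const_mul (hE.add_const (energy a G))
      (Or.inr (by simp : (2 : ℝ≥0∞) ≠ ⊤))
  calc ∫⁻ x, T u x ∂powMeasure N s
      ≤ ∫⁻ x, liminf (fun n => T (φ n) x) atTop ∂powMeasure N s :=
        lintegral_mono_ae (ae_powMeasure_iff.2 ((hT φ hlim).mono fun x hx => hx.liminf_eq.ge))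
    _ ≤ liminf (fun n => ∫⁻ x, T (φ n) x ∂powMeasure N s) atTop :=
        lintegral_liminf_le fun n => hTm _ (hφ n)
    _ ≤ liminf (fun n => B (2 * (energy a (gradient (φ n) - G) + energy a G))) atTop :=
        liminf_le_liminf (Eventually.of_forall fun n =>
          (h _ (hφ n)).trans (hBm (energy_gradient_le hG (hφ n))))
    _ = _ := h0.liminf_eq

/-- The Caffarelli-Kohn-Nirenberg inequality in `D^{1,2}_a`. -/
theorem exists_ckn_const (hN : 3 ≤ N) {a b p : ℝ} (ha : a < ((N : ℝ) - 2) / 2)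
    (hab : a ≤ b) (hba : b < a + 1) (hp : p = 2 * (N : ℝ) / ((N : ℝ) - 2 * (1 + a - b))) :
    ∃ C : ℝ≥0∞, C ≠ ⊤ ∧ ∀ (w : Euc N → ℝ) (H : Euc N → Euc N), HasGradientInD a w H →
      ∫⁻ x, ‖w x‖ₑ ^ p ∂powMeasure N (-(b * p)) ≤ C * energy a H ^ (p / 2) := by
  have : NeZero N := ⟨by omega⟩
  have hN' : (3 : ℝ) ≤ N := by exact_mod_cast hN
  have hp0 : 0 < p := by rw [hp]; apply div_pos <;> linarith
  obtain ⟨C, hC, h⟩ := exists_ckn_const_of_contDiff hN ha hab hba hp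
  refine ⟨C * 2 ^ (p / 2), ENNReal.mul_ne_top hC
    (ENNReal.rpow_ne_top_of_nonneg (by positivity) (by simp)), fun w H hw => ?_⟩
  refine (hw.lintegral_le_of_test (T := fun φ x => ‖φ x‖ₑ ^ p) (B := fun z => C * z ^ (p / 2))
    ((ENNReal.continuous_const_mul hC).comp ENNReal.continuous_rpow_const)
    (fun y z hyz => ?_) (fun φ hφ => hφ.contDiff_one.continuous.measurable.enorm.pow_const p)
    (fun φ hφ => ?_) (fun φ hφ => h φ hφ.contDiff_one hφ.2)).trans (le_of_eq ?_)
  · dsimp only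
    gcongr
  · filter_upwards [hφ] with x hx
    exact (ENNReal.continuous_rpow_const.tendsto _).comp hx.enorm
  · rw [ENNReal.mul_rpow_of_nonneg _ _ (by positivity), mul_assoc]

theorem HasGradientInD.lintegral_dil_sub_sq_le [NeZero N] {α : ℝ} (hα : 0 < α)
    (hs : 2 * (α + 1) = N + -(2 * a)) (hu : HasGradientInD a u G) (t : ℝ) :
    ∫⁻ x, ‖_root_.dil α t u x - u x‖ₑ ^ 2 ∂powMeasure N (-(2 * a) - 2) ≤
      ENNReal.ofReal |t| ^ 2 * (8 * energy a G) := by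
  -- The constant `8` is the `4` of the smooth case times the factor `2` lost in comparing the
  -- energies of the approximations with that of the limit.
  refine (hu.lintegral_le_of_test (T := fun φ x => ‖_root_.dil α t φ x - φ x‖ₑ ^ 2)
    (B := fun z => ENNReal.ofReal |t| ^ 2 * (4 * z)) ?_
    (fun y z hyz => ?_) (fun φ hφ => ?_) (fun φ hφ => ?_) (fun φ hφ => ?_)).trans (le_of_eq ?_)
  · exact (ENNReal.continuous_const_mul (by simp)).comp (ENNReal.continuous_const_mul (by simp))
  · dsimp only
    gcongr
  · exact (((hφ.dil α t).contDiff_one.continuous.sub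
      hφ.contDiff_one.continuous).measurable.enorm).pow_const 2
  · filter_upwards [hφ, (quasiMeasurePreserving_exp_smul t).ae hφ] with x hx hx'
    exact (ENNReal.continuous_pow 2).tendsto _ |>.comp ((hx'.const_smul _).sub hx).enorm
  · have := lintegral_dil_sub_sq_le_of_contDiff (s := -(2 * a) - 2) hα (by linarith)
      hφ.contDiff_one hφ.2 t
    rwa [sub_add_cancel] at this
  · ring

end Energy

/-! ### Taylor estimates for powers and Hölder's inequality -/

section Inequalities

theorem abs_rpow_sub_rpow_le {q r s : ℝ} (hq : 1 ≤ q) (hr : 0 < r) (hs : 0 < s) :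
    |s ^ q - r ^ q| ≤ q * (s ^ (q - 1) + r ^ (q - 1)) * |s - r| := by
  have hpos : ∀ y ∈ Set.uIcc r s, 0 < y := fun y hy => (lt_min hr hs).trans_le hy.1
  refine Convex.norm_image_sub_le_of_norm_hasDerivWithin_le (f := fun y : ℝ => y ^ q)
    (s := Set.uIcc r s) (fun y hy =>
      (Real.hasDerivAt_rpow_const (Or.inl (hpos y hy).ne')).hasDerivWithinAt) (fun y hy => ?_)
    (convex_uIcc r s) Set.left_mem_uIcc Set.right_mem_uIcc
  have hy0 := hpos y hy
  rw [Real.norm_of_nonneg (by positivity)]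
  gcongr
  have h1 : y ^ (q - 1) ≤ max r s ^ (q - 1) :=
    Real.rpow_le_rpow hy0.le hy.2 (by linarith)
  rcases max_cases r s with ⟨h, _⟩ | ⟨h, _⟩ <;> rw [h] at h1
  · exact h1.trans (le_add_of_nonneg_left (by positivity))
  · exact h1.trans (le_add_of_nonneg_right (by positivity))

/-- The mean value inequality is applied to `y^p - p r^{p-1} y`, whose derivative vanishes at `r`
and is itself estimated by `abs_rpow_sub_rpow_le`. -/
theorem abs_rpow_sub_sub_le {p r s : ℝ} (hp : 2 ≤ p) (hr : 0 < r) (hs : 0 < s) :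
    |s ^ p - r ^ p - p * r ^ (p - 1) * (s - r)| ≤
      2 * p * (p - 1) * (s ^ (p - 2) + r ^ (p - 2)) * (s - r) ^ 2 := by
  have hpos : ∀ y ∈ Set.uIcc r s, 0 < y := fun y hy => (lt_min hr hs).trans_le hy.1
  have hp1 : 0 ≤ p - 1 := by linarith
  have key := Convex.norm_image_sub_le_of_norm_hasDerivWithin_le
    (f := fun y : ℝ => y ^ p - p * r ^ (p - 1) * y)
    (f' := fun y => p * y ^ (p - 1) - p * r ^ (p - 1))
    (s := Set.uIcc r s) (C := 2 * p * (p - 1) * (s ^ (p - 2) + r ^ (p - 2)) * |s - r|)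
    (fun y hy => ?_) (fun y hy => ?_) (convex_uIcc r s) Set.left_mem_uIcc Set.right_mem_uIcc
  · rw [Real.norm_eq_abs, Real.norm_eq_abs, mul_assoc _ (|s - r|), ← sq, sq_abs] at key
    convert key using 2
    ring
  · have := (Real.hasDerivAt_rpow_const (p := p) (Or.inl (hpos y hy).ne')).sub
      ((hasDerivAt_id y).const_mul (p * r ^ (p - 1)))
    rw [mul_one] at this
    exact this.hasDerivWithinAt
  · have hy0 := hpos y hy
    have h1 : y ^ (p - 2) ≤ max r s ^ (p - 2) :=
      Real.rpow_le_rpow hy0.le hy.2 (by linarith)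
    have h2 : y ^ (p - 2) + r ^ (p - 2) ≤ 2 * (s ^ (p - 2) + r ^ (p - 2)) := by
      have e1 := Real.rpow_nonneg hr.le (p - 2)
      have e2 := Real.rpow_nonneg hs.le (p - 2)
      rcases max_cases r s with ⟨h, _⟩ | ⟨h, _⟩ <;> rw [h] at h1 <;> linarith
    have h3 := abs_rpow_sub_rpow_le (q := p - 1) (by linarith) hr hy0
    rw [show p - 1 - 1 = p - 2 by ring] at h3
    have h4 : |y - r| ≤ |s - r| := Set.abs_sub_left_of_mem_uIcc hy
    rw [← mul_sub, norm_mul, Real.norm_of_nonneg (by linarith : 0 ≤ p), Real.norm_eq_abs]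
    calc p * |y ^ (p - 1) - r ^ (p - 1)|
        ≤ p * ((p - 1) * (2 * (s ^ (p - 2) + r ^ (p - 2))) * |s - r|) := by
          refine mul_le_mul_of_nonneg_left (h3.trans ?_) (by linarith)
          gcongr
      _ = _ := by ring

theorem enorm_rpow_of_pos {r : ℝ} (hr : 0 < r) (c : ℝ) : ‖r ^ c‖ₑ = ‖r‖ₑ ^ c := by
  rw [Real.enorm_of_nonneg (by positivity), Real.enorm_of_nonneg hr.le,
    ENNReal.ofReal_rpow_of_pos hr]

theorem lintegral_rpow_mul_rpow_le {α : Type*} [MeasurableSpace α] {μ : Measure α}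
    {f g : α → ℝ≥0∞} (hf : AEMeasurable f μ) (hg : AEMeasurable g μ) {p r : ℝ} (hp : 0 < p)
    (hr : 0 ≤ r) (hrp : r ≤ p) :
    ∫⁻ x, f x ^ (p - r) * g x ^ r ∂μ ≤
      (∫⁻ x, f x ^ p ∂μ) ^ ((p - r) / p) * (∫⁻ x, g x ^ p ∂μ) ^ (r / p) := by
  refine le_trans (le_of_eq (lintegral_congr fun x => ?_)) (ENNReal.lintegral_mul_norm_pow_le
    (hf.pow_const p) (hg.pow_const p) (div_nonneg (sub_nonneg.2 hrp) hp.le)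
    (div_nonneg hr hp.le) (by field_simp; ring))
  rw [← ENNReal.rpow_mul, ← ENNReal.rpow_mul, mul_div_cancel₀ _ hp.ne', mul_div_cancel₀ _ hp.ne']

end Inequalities

/-! ### Scaling of the exponents and control of the potential `u^{p-2}` -/

/-- The relations between the parameters of the Caffarelli-Kohn-Nirenberg inequality; the
dilations `dil α t` act isometrically on `D^{1,2}_a`. -/
structure CKNExponents (N : ℕ) (a b p α : ℝ) : Prop where
  three_le : 3 ≤ N
  lt : a < ((N : ℝ) - 2) / 2
  le : a ≤ b
  lt_add_one : b < a + 1
  eq_div : p = 2 * (N : ℝ) / ((N : ℝ) - 2 * (1 + a - b))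
  eq_half : α = (N - 2 - 2 * a) / 2

namespace CKNExponents

variable {N : ℕ} {a b p α : ℝ} (h : CKNExponents N a b p α)

include h

theorem neZero : NeZero N := ⟨by have := h.three_le; omega⟩

theorem three_le_cast : (3 : ℝ) ≤ N := by exact_mod_cast h.three_le

theorem two_lt : 2 < p := by
  have h1 := h.three_le_cast
  have h2 := h.le
  have h3 := h.lt_add_one
  rw [h.eq_div, lt_div_iff₀] <;> linarith

theorem α_pos : 0 < α := by
  have := h.lt
  rw [h.eq_half]
  linarith

theorem two_mul_add_one : 2 * (α + 1) = N + -(2 * a) := by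
  rw [h.eq_half]
  ring

/-- The amplitude `α` that preserves the energy also preserves the `L^p(|x|^{-bp} dx)` norm: this is
the scale invariance of the inequality. -/
theorem mul_p : α * p = N + -(b * p) := by
  have h1 := h.three_le_cast
  have h2 := h.le
  have h3 : (N : ℝ) - 2 * (1 + a - b) ≠ 0 := by linarith
  rw [h.eq_half, h.eq_div]
  field_simp
  ring

theorem two_mul_lt : 2 * a < N := by
  have := h.lt
  linarith

theorem exists_ckn : ∃ C : ℝ≥0∞, C ≠ ⊤ ∧ ∀ (w : Euc N → ℝ) (H : Euc N → Euc N),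
    HasGradientInD a w H →
      ∫⁻ x, ‖w x‖ₑ ^ p ∂powMeasure N (-(b * p)) ≤ C * energy a H ^ (p / 2) :=
  exists_ckn_const h.three_le h.lt h.le h.lt_add_one h.eq_div

theorem lintegral_rpow_lt_top {w : Euc N → ℝ} {H : Euc N → Euc N} (hw : HasGradientInD a w H) :
    ∫⁻ x, ‖w x‖ₑ ^ p ∂powMeasure N (-(b * p)) < ⊤ := by
  have := h.neZero
  have := h.two_lt
  obtain ⟨C, hC, hckn⟩ := h.exists_ckn
  exact (hckn w H hw).trans_lt (ENNReal.mul_lt_top hC.lt_top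
    (ENNReal.rpow_lt_top_of_nonneg (by linarith) (hw.energy_lt_top h.two_mul_lt).ne))

/-- Hölder's inequality combined with the Caffarelli-Kohn-Nirenberg inequality. -/
theorem exists_hoelder_const : ∃ C : ℝ≥0∞, C ≠ ⊤ ∧ ∀ (f w : Euc N → ℝ) (H : Euc N → Euc N),
    AEStronglyMeasurable f volume → HasGradientInD a w H → ∀ r : ℝ, 0 ≤ r → r ≤ p →
      ∫⁻ x, ‖f x‖ₑ ^ (p - r) * ‖w x‖ₑ ^ r ∂powMeasure N (-(b * p)) ≤
        (∫⁻ x, ‖f x‖ₑ ^ p ∂powMeasure N (-(b * p))) ^ ((p - r) / p) *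
          (C ^ (r / p) * energy a H ^ (r / 2)) := by
  have hp := h.two_lt
  obtain ⟨C, hC, hckn⟩ := h.exists_ckn
  refine ⟨C, hC, fun f w H hf hw r hr hrp => ?_⟩
  refine (lintegral_rpow_mul_rpow_le (aestronglyMeasurable_powMeasure hf).enorm
    (aestronglyMeasurable_powMeasure hw.aestronglyMeasurable).enorm (by linarith) hr hrp).trans ?_
  refine mul_le_mul' le_rfl ((ENNReal.rpow_le_rpow (hckn w H hw) (by positivity)).trans
    (le_of_eq ?_))
  rw [ENNReal.mul_rpow_of_nonneg _ _ (by positivity), ← ENNReal.rpow_mul]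
  congr 2
  field_simp

/-- The potential `u^{p-2}` is form-small with respect to the energy, up to a multiple of the
Hardy norm. -/
theorem exists_lintegral_potential_le {u : Euc N → ℝ} (hum : Measurable u)
    (hu : ∫⁻ x, ‖u x‖ₑ ^ p ∂powMeasure N (-(b * p)) ≠ ⊤) {ε : ℝ≥0∞} (hε : 0 < ε) :
    ∃ M : ℝ≥0∞, M ≠ ⊤ ∧ ∀ (w : Euc N → ℝ) (H : Euc N → Euc N), HasGradientInD a w H →
      ∫⁻ x, ‖u x‖ₑ ^ (p - 2) * ‖w x‖ₑ ^ 2 ∂powMeasure N (-(b * p)) ≤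
        ε * energy a H + M * ∫⁻ x, ‖w x‖ₑ ^ 2 ∂powMeasure N (-(2 * a) - 2) := by
  have := h.neZero
  have hp := h.two_lt
  obtain ⟨C, hC, hhol⟩ := h.exists_hoelder_const
  -- `W` is the density of `u^{p-2} |x|^{-bp} dx` relative to the Hardy weight. Where `W ≤ n` the
  -- integral is at most `n` times the Hardy norm.
  set W : Euc N → ℝ≥0∞ := fun x =>
    ENNReal.ofReal (‖x‖ ^ (2 * a + 2 - b * p)) * ‖u x‖ₑ ^ (p - 2) with hW
  have hWm : Measurable W :=
    (measurable_ofReal_norm_rpow _).mul (hum.enorm.pow_const _)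
  let S : ℕ → Set (Euc N) := fun n => {x | (n : ℝ≥0∞) < W x}
  have hS : ∀ n, MeasurableSet (S n) := fun n => measurableSet_lt measurable_const hWm
  let τ : ℕ → ℝ≥0∞ := fun n => ∫⁻ x, ‖(S n).indicator u x‖ₑ ^ p ∂powMeasure N (-(b * p))
  have hle : ∀ n x, ‖(S n).indicator u x‖ₑ ≤ ‖u x‖ₑ := fun n x => by
    by_cases hx : x ∈ S n
    · rw [Set.indicator_of_mem hx]
    · rw [Set.indicator_of_notMem hx]; simp
  -- Since `W` is finite at every point, the sets `S n` eventually exclude it, and dominated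
  -- convergence by `u^p` makes the tail mass vanish. Hölder turns this into a small multiple of the
  -- energy, so any large level `n` serves as `M`.
  have hτ : Tendsto τ atTop (𝓝 0) := by
    have := tendsto_lintegral_of_dominated_convergence (μ := powMeasure N (-(b * p)))
      (F := fun n x => ‖(S n).indicator u x‖ₑ ^ p) (f := fun _ => 0) (fun x => ‖u x‖ₑ ^ p)
      (fun n => (hum.indicator (hS n)).enorm.pow_const p)
      (fun n => Eventually.of_forall fun x => ENNReal.rpow_le_rpow (hle n x) (by linarith)) hu
      (Eventually.of_forall fun x => ?_)
    · simpa using this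
    · have hWx : W x ≠ ⊤ := ENNReal.mul_ne_top ENNReal.ofReal_ne_top
        (ENNReal.rpow_ne_top_of_nonneg (by linarith) enorm_ne_top)
      obtain ⟨m, hm⟩ := ENNReal.exists_nat_gt hWx
      refine tendsto_const_nhds.congr' ?_
      filter_upwards [eventually_ge_atTop m] with n hn
      have : x ∉ S n := by
        simp only [S, Set.mem_ofPred_eq, not_lt]
        exact hm.le.trans (by exact_mod_cast hn)
      rw [Set.indicator_of_notMem this, enorm_zero, ENNReal.zero_rpow_of_pos (by linarith)]
  have hlim : Tendsto (fun n => τ n ^ ((p - 2) / p) * C ^ (2 / p)) atTop (𝓝 0) := by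
    have h1 : Tendsto (fun n => τ n ^ ((p - 2) / p)) atTop (𝓝 0) := by
      have := (ENNReal.continuous_rpow_const (y := (p - 2) / p)).tendsto 0 |>.comp hτ
      rwa [ENNReal.zero_rpow_of_pos (div_pos (by linarith) (by linarith))] at this
    simpa using ENNReal.Tendsto.mul_const h1
      (Or.inr (ENNReal.rpow_ne_top_of_nonneg (div_nonneg (by norm_num) (by linarith)) hC))
  obtain ⟨n, hn⟩ := (hlim.eventually_lt_const hε).exists
  refine ⟨n, ENNReal.natCast_ne_top n, fun w H hw => ?_⟩
  have hwm := aestronglyMeasurable_powMeasure (s := -(2 * a) - 2) hw.aestronglyMeasurable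
  have hexp : -(2 * a) - 2 + (2 * a + 2 - b * p) = -(b * p) := by ring
  have hpt : ∀ x, ENNReal.ofReal (‖x‖ ^ (2 * a + 2 - b * p)) * (‖u x‖ₑ ^ (p - 2) * ‖w x‖ₑ ^ 2) ≤
      n * ‖w x‖ₑ ^ 2 + ENNReal.ofReal (‖x‖ ^ (2 * a + 2 - b * p)) *
        (‖(S n).indicator u x‖ₑ ^ (p - 2) * ‖w x‖ₑ ^ 2) := by
    intro x
    by_cases hx : x ∈ S n
    · rw [Set.indicator_of_mem hx]
      exact le_add_self
    · rw [← mul_assoc]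
      refine le_add_right (mul_le_mul' ?_ le_rfl)
      simpa [S] using hx
  calc ∫⁻ x, ‖u x‖ₑ ^ (p - 2) * ‖w x‖ₑ ^ 2 ∂powMeasure N (-(b * p))
      = ∫⁻ x, ENNReal.ofReal (‖x‖ ^ (2 * a + 2 - b * p)) * (‖u x‖ₑ ^ (p - 2) * ‖w x‖ₑ ^ 2)
          ∂powMeasure N (-(2 * a) - 2) := by rw [lintegral_rpow_mul_powMeasure, hexp]
    _ ≤ ∫⁻ x, (n * ‖w x‖ₑ ^ 2 + ENNReal.ofReal (‖x‖ ^ (2 * a + 2 - b * p)) *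
        (‖(S n).indicator u x‖ₑ ^ (p - 2) * ‖w x‖ₑ ^ 2)) ∂powMeasure N (-(2 * a) - 2) :=
        lintegral_mono hpt
    _ = n * ∫⁻ x, ‖w x‖ₑ ^ 2 ∂powMeasure N (-(2 * a) - 2) +
        ∫⁻ x, ‖(S n).indicator u x‖ₑ ^ (p - 2) * ‖w x‖ₑ ^ (2 : ℝ) ∂powMeasure N (-(b * p)) := by
        rw [lintegral_add_left' ((hwm.enorm.pow_const 2).const_mul _),
          lintegral_const_mul' _ _ (ENNReal.natCast_ne_top n), lintegral_rpow_mul_powMeasure, hexp]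
        simp only [ENNReal.rpow_ofNat]
    _ ≤ n * ∫⁻ x, ‖w x‖ₑ ^ 2 ∂powMeasure N (-(2 * a) - 2) +
        τ n ^ ((p - 2) / p) * (C ^ (2 / p) * energy a H ^ ((2 : ℝ) / 2)) :=
        add_le_add le_rfl (hhol _ w H (hum.indicator (hS n)).aestronglyMeasurable hw 2
          (by norm_num) hp.le)
    _ ≤ _ := by
        rw [add_comm, ← mul_assoc, div_self (two_ne_zero), ENNReal.rpow_one]
        exact add_le_add (mul_le_mul' hn.le le_rfl) le_rfl

end CKNExponents

/-! ### Dilation invariance of integrals and polarization of the energy -/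

section DilIntegral

variable {N : ℕ} {s κ : ℝ}

theorem integral_dil (h : κ = N + s) (t : ℝ) (f : Euc N → ℝ) :
    ∫ x, dil κ t f x ∂powMeasure N s = ∫ x, f x ∂powMeasure N s := by
  simp only [dil, smul_eq_mul]
  rw [integral_const_mul, integral_comp_exp_smul, ← mul_assoc, ← Real.exp_add, h, neg_mul,
    add_neg_cancel, Real.exp_zero, one_mul]

theorem lintegral_exp_mul_comp_exp_smul (h : κ = N + s) (t : ℝ) (f : Euc N → ℝ≥0∞) :
    ∫⁻ x, ENNReal.ofReal (Real.exp (κ * t)) * f (Real.exp t • x) ∂powMeasure N s =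
      ∫⁻ x, f x ∂powMeasure N s := by
  rw [lintegral_const_mul' _ _ ENNReal.ofReal_ne_top, lintegral_comp_exp_smul, ← mul_assoc,
    ← ENNReal.ofReal_mul (Real.exp_pos _).le, ← Real.exp_add, h, neg_mul, add_neg_cancel,
    Real.exp_zero, ENNReal.ofReal_one, one_mul]

end DilIntegral

section Inner

variable {N : ℕ} {a : ℝ} {G H : Euc N → Euc N}

theorem lintegral_enorm_inner_le (hG : AEStronglyMeasurable G volume)
    (hH : AEStronglyMeasurable H volume) :
    ∫⁻ x, ‖(inner ℝ (G x) (H x) : ℝ)‖ₑ ∂powMeasure N (-(2 * a)) ≤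
      energy a G ^ (1 / 2 : ℝ) * energy a H ^ (1 / 2 : ℝ) := by
  have e : ∀ z : ℝ≥0∞, (z ^ 2) ^ (1 / 2 : ℝ) = z := fun z => by
    rw [← ENNReal.rpow_natCast, ← ENNReal.rpow_mul]; norm_num
  refine (lintegral_mono fun x => ?_).trans (ENNReal.lintegral_mul_norm_pow_le
    ((aestronglyMeasurable_powMeasure hG).enorm.pow_const 2)
    ((aestronglyMeasurable_powMeasure hH).enorm.pow_const 2) (p := 1 / 2) (q := 1 / 2)
    (by norm_num) (by norm_num) (by norm_num))
  simp only [e]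
  exact enorm_inner_le _ _

theorem integrable_inner_powMeasure (hG : AEStronglyMeasurable G volume)
    (hH : AEStronglyMeasurable H volume) (hG' : energy a G ≠ ⊤) (hH' : energy a H ≠ ⊤) :
    Integrable (fun x => (inner ℝ (G x) (H x) : ℝ)) (powMeasure N (-(2 * a))) :=
  ⟨aestronglyMeasurable_powMeasure (hG.inner hH),
    (lintegral_enorm_inner_le hG hH).trans_lt (ENNReal.mul_lt_top
      (ENNReal.rpow_lt_top_of_nonneg (by norm_num) hG')
      (ENNReal.rpow_lt_top_of_nonneg (by norm_num) hH'))⟩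

theorem toReal_energy (hG : AEStronglyMeasurable G volume) :
    (energy a G).toReal = ∫ x, inner ℝ (G x) (G x) ∂powMeasure N (-(2 * a)) := by
  rw [integral_eq_lintegral_of_nonneg_ae (Eventually.of_forall fun x => real_inner_self_nonneg)
    (aestronglyMeasurable_powMeasure (hG.inner hG)), energy]
  congr 1
  refine lintegral_congr fun x => ?_
  rw [real_inner_self_eq_norm_sq, ENNReal.ofReal_pow (norm_nonneg _), ofReal_norm]

/-- In `|H - G|² = |H|² - |G|² - 2 G · (H - G)`, equality of the energies removes the first two
terms after integration. -/
theorem toReal_energy_sub (hG : AEStronglyMeasurable G volume)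
    (hH : AEStronglyMeasurable H volume) (hG' : energy a G ≠ ⊤) (h : energy a H = energy a G) :
    (energy a (H - G)).toReal =
      -2 * ∫ x, inner ℝ (G x) ((H - G) x) ∂powMeasure N (-(2 * a)) := by
  have hH' : energy a H ≠ ⊤ := h ▸ hG'
  have hE : energy a (H - G) ≠ ⊤ := ((energy_sub_le hH G).trans_lt (ENNReal.mul_lt_top (by simp)
    (ENNReal.add_lt_top.2 ⟨hH'.lt_top, hG'.lt_top⟩))).ne
  have i1 := integrable_inner_powMeasure hH hH hH' hH'
  have i2 := integrable_inner_powMeasure hG hG hG' hG'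
  have i3 := integrable_inner_powMeasure hG (hH.sub hG) hG' hE
  have e1 := toReal_energy (a := a) hH
  rw [h, toReal_energy hG] at e1
  rw [toReal_energy (hH.sub hG)]
  have : ∀ x, inner ℝ ((H - G) x) ((H - G) x) =
      (inner ℝ (H x) (H x) - inner ℝ (G x) (G x)) + -2 * inner ℝ (G x) ((H - G) x) := by
    intro x
    simp only [Pi.sub_apply, inner_sub_left, inner_sub_right, real_inner_comm (H x) (G x)]
    ring
  rw [integral_congr_ae (Eventually.of_forall this),
    integral_add (f := fun x => inner ℝ (H x) (H x) - inner ℝ (G x) (G x))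
      (i1.sub i2) (i3.const_mul _), integral_sub i1 i2, e1, sub_self, zero_add, integral_const_mul]

/-- Dilating by `t`, an isometry, carries the difference for `-t` to minus the difference for `t`.
-/
theorem energy_dil_neg_sub {κ : ℝ} (hκ : 2 * κ = N + -(2 * a)) (t : ℝ) (G : Euc N → Euc N) :
    energy a (dil κ (-t) G - G) = energy a (dil κ t G - G) := by
  rw [← energy_dil hκ t, dil_sub, dil_dil, add_neg_cancel, dil_zero, energy_sub_comm]

end Inner

/-! ### Variation of `K` along dilations; power estimates in extended norms -/

section Coefficient

variable {N : ℕ} {K : Euc N → ℝ} {C : ℝ}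

theorem abs_dil_zero_sub_le (hK : ContDiff ℝ 1 K) (hC : ∀ x, |inner ℝ (gradient K x) x| ≤ C)
    (t : ℝ) (x : Euc N) : |dil 0 t K x - K x| ≤ C * |t| := by
  rw [dil_sub_eq_integral hK]
  have := intervalIntegral.norm_integral_le_of_norm_le_const (a := 0) (b := t) (C := C)
    (f := fun r => dil 0 r (euler 0 K) x) fun r _ => by
      simp only [dil, euler, zero_mul, zero_add, Real.exp_zero, one_smul]
      exact hC _
  simpa using this

theorem enorm_rpow_sub_rpow_le {q r s : ℝ} (hq : 1 ≤ q) (hr : 0 < r) (hs : 0 < s) :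
    ‖s ^ q - r ^ q‖ₑ ≤ ENNReal.ofReal q * (‖s‖ₑ ^ (q - 1) + ‖r‖ₑ ^ (q - 1)) * ‖s - r‖ₑ := by
  have h := ENNReal.ofReal_le_ofReal (abs_rpow_sub_rpow_le hq hr hs)
  rwa [ENNReal.ofReal_mul (by positivity), ENNReal.ofReal_mul (by positivity),
    ENNReal.ofReal_add (by positivity) (by positivity), ← Real.enorm_eq_ofReal_abs,
    ← Real.enorm_eq_ofReal_abs, ← Real.enorm_of_nonneg (by positivity : 0 ≤ s ^ (q - 1)),
    ← Real.enorm_of_nonneg (by positivity : 0 ≤ r ^ (q - 1)), enorm_rpow_of_pos hs,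
    enorm_rpow_of_pos hr] at h

theorem enorm_rpow_sub_sub_le {p r s : ℝ} (hp : 2 ≤ p) (hr : 0 < r) (hs : 0 < s) :
    ‖s ^ p - r ^ p - p * r ^ (p - 1) * (s - r)‖ₑ ≤
      ENNReal.ofReal (2 * p * (p - 1)) *
        ((‖s‖ₑ ^ (p - 2) + ‖r‖ₑ ^ (p - 2)) * ‖s - r‖ₑ ^ 2) := by
  have h := ENNReal.ofReal_le_ofReal (abs_rpow_sub_sub_le hp hr hs)
  have hp1 : 0 ≤ 2 * p * (p - 1) := mul_nonneg (by linarith) (by linarith)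
  rwa [mul_assoc (2 * p * (p - 1)), ENNReal.ofReal_mul hp1,
    ENNReal.ofReal_mul (p := s ^ (p - 2) + r ^ (p - 2)) (by positivity),
    ENNReal.ofReal_add (by positivity) (by positivity), ← Real.enorm_eq_ofReal_abs, ← sq_abs,
    ENNReal.ofReal_pow (abs_nonneg _), ← Real.enorm_eq_ofReal_abs,
    ← Real.enorm_of_nonneg (by positivity : 0 ≤ s ^ (p - 2)),
    ← Real.enorm_of_nonneg (by positivity : 0 ≤ r ^ (p - 2)), enorm_rpow_of_pos hs,
    enorm_rpow_of_pos hr] at h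

end Coefficient

/-! ### Extension of the weak formulation to `D^{1,2}_a` -/

/-- A positive weak solution represented by an everywhere positive measurable function `u`, with
the weak formulation written in terms of the weighted measures. -/
structure PositiveSolution {N : ℕ} (a b p : ℝ) (K u : Euc N → ℝ) (G : Euc N → Euc N) : Prop where
  measurable : Measurable u
  pos : ∀ x, 0 < u x
  grad : HasGradientInD a u G
  weak : ∀ φ : Euc N → ℝ, IsTestFunction φ →
    ∫ x, inner ℝ (G x) (gradient φ x) ∂powMeasure N (-(2 * a)) =
      ∫ x, K x * u x ^ (p - 1) * φ x ∂powMeasure N (-(b * p))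

namespace PositiveSolution

variable {N : ℕ} {a b p α : ℝ} {K u : Euc N → ℝ} {G : Euc N → Euc N}

theorem dil_pos (S : PositiveSolution a b p K u G) (t : ℝ) (x : Euc N) : 0 < dil α t u x :=
  mul_pos (Real.exp_pos _) (S.pos _)

theorem measurable_dil (S : PositiveSolution a b p K u G) (t : ℝ) : Measurable (dil α t u) :=
  (S.measurable.comp (measurableEmbedding_exp_smul t).measurable).const_smul (Real.exp (α * t))

theorem integrable_mul_rpow_mul (h : CKNExponents N a b p α) {v w L : Euc N → ℝ}
    {H : Euc N → Euc N} {C : ℝ} (hL : Continuous L) (hC : ∀ x, |L x| ≤ C) (hv : Measurable v)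
    (hpos : ∀ x, 0 < v x) (hvp : ∫⁻ x, ‖v x‖ₑ ^ p ∂powMeasure N (-(b * p)) ≠ ⊤)
    (hw : HasGradientInD a w H) :
    Integrable (fun x => L x * v x ^ (p - 1) * w x) (powMeasure N (-(b * p))) := by
  have := h.neZero
  have hp := h.two_lt
  obtain ⟨C', hC', hhol⟩ := h.exists_hoelder_const
  have h1 : Integrable (fun x => v x ^ (p - 1) * w x) (powMeasure N (-(b * p))) := by
    refine ⟨aestronglyMeasurable_powMeasure ((hv.pow_const _).aestronglyMeasurable.mul
      hw.aestronglyMeasurable), ?_⟩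
    have h2 := hhol v w H hv.aestronglyMeasurable hw 1 zero_le_one (by linarith)
    refine lt_of_le_of_lt ((lintegral_mono fun x => ?_).trans h2) (ENNReal.mul_lt_top
      (ENNReal.rpow_lt_top_of_nonneg (div_nonneg (by linarith) (by linarith)) hvp)
      (ENNReal.mul_lt_top (ENNReal.rpow_lt_top_of_nonneg (by positivity) hC')
      (ENNReal.rpow_lt_top_of_nonneg (by norm_num) (hw.energy_lt_top h.two_mul_lt).ne)))
    rw [enorm_mul, enorm_rpow_of_pos (hpos x), ENNReal.rpow_one]
  have h3 := h1.bdd_mul (c := C) hL.aestronglyMeasurable (Eventually.of_forall hC)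
  simpa only [mul_assoc] using h3

/-- The weak formulation holds for all test functions in `D^{1,2}_a`. -/
theorem weak_of_hasGradientInD (S : PositiveSolution a b p K u G) (h : CKNExponents N a b p α)
    {C : ℝ} (hK : Continuous K) (hC : ∀ x, |K x| ≤ C) {w : Euc N → ℝ} {H : Euc N → Euc N}
    (hw : HasGradientInD a w H) :
    ∫ x, inner ℝ (G x) (H x) ∂powMeasure N (-(2 * a)) =
      ∫ x, K x * u x ^ (p - 1) * w x ∂powMeasure N (-(b * p)) := by
  have := h.neZero
  have hp := h.two_lt
  have hup := (h.lintegral_rpow_lt_top S.grad).ne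
  have hG := S.grad.1
  have hGe := (S.grad.energy_lt_top h.two_mul_lt).ne
  have hHe := (hw.energy_lt_top h.two_mul_lt).ne
  obtain ⟨C', hC', hhol⟩ := h.exists_hoelder_const
  obtain ⟨hH, φ, hφ, hlim, hE⟩ := hasGradientInD_iff.1 hw
  have hE2 : Tendsto (fun n => energy a (gradient (φ n) - H) ^ (1 / 2 : ℝ)) atTop (𝓝 0) := by
    have := (ENNReal.continuous_rpow_const (y := (1 / 2 : ℝ))).tendsto 0 |>.comp hE
    rwa [ENNReal.zero_rpow_of_pos (by norm_num)] at this
  -- Both sides of the weak formulation are continuous in the test function for the energy norm: the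
  -- left by Cauchy-Schwarz, the right by Hölder and Caffarelli-Kohn-Nirenberg.
  have hl : Tendsto (fun n => ∫ x, inner ℝ (G x) (gradient (φ n) x) ∂powMeasure N (-(2 * a)))
      atTop (𝓝 (∫ x, inner ℝ (G x) (H x) ∂powMeasure N (-(2 * a)))) := by
    refine tendsto_integral_of_L1 _
      (integrable_inner_powMeasure hG hH hGe hHe).aestronglyMeasurable
      (Eventually.of_forall fun n => integrable_inner_powMeasure hG
        (hφ n).continuous_gradient.aestronglyMeasurable hGe
        (energy_gradient_lt_top h.two_mul_lt (hφ n)).ne) ?_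
    have h0 : Tendsto (fun n => energy a G ^ (1 / 2 : ℝ) *
        energy a (gradient (φ n) - H) ^ (1 / 2 : ℝ)) atTop (𝓝 0) := by
      simpa using ENNReal.Tendsto.const_mul hE2
        (Or.inr (ENNReal.rpow_ne_top_of_nonneg (by norm_num : (0 : ℝ) ≤ 1 / 2) hGe))
    refine tendsto_of_tendsto_of_tendsto_of_le_of_le tendsto_const_nhds h0
      (fun _ => zero_le) fun n => ?_
    simp only [← inner_sub_right]
    exact lintegral_enorm_inner_le hG ((hφ n).continuous_gradient.aestronglyMeasurable.sub hH)
  have hr : Tendsto (fun n => ∫ x, K x * u x ^ (p - 1) * φ n x ∂powMeasure N (-(b * p)))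
      atTop (𝓝 (∫ x, K x * u x ^ (p - 1) * w x ∂powMeasure N (-(b * p)))) := by
    refine tendsto_integral_of_L1 _
      (integrable_mul_rpow_mul h hK hC S.measurable S.pos hup hw).aestronglyMeasurable
      (Eventually.of_forall fun n => integrable_mul_rpow_mul h hK hC S.measurable S.pos hup
        (hφ n).hasGradientInD) ?_
    set A : ℝ≥0∞ := ENNReal.ofReal C *
      ((∫⁻ x, ‖u x‖ₑ ^ p ∂powMeasure N (-(b * p))) ^ ((p - 1) / p) * C' ^ (1 / p)) with hA
    have hAt : A ≠ ⊤ := ENNReal.mul_ne_top ENNReal.ofReal_ne_top (ENNReal.mul_ne_top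
      (ENNReal.rpow_ne_top_of_nonneg (div_nonneg (by linarith) (by linarith)) hup)
      (ENNReal.rpow_ne_top_of_nonneg (by positivity) hC'))
    have h0 : Tendsto (fun n => A * energy a (gradient (φ n) - H) ^ (1 / 2 : ℝ)) atTop (𝓝 0) := by
      simpa using ENNReal.Tendsto.const_mul hE2 (Or.inr hAt)
    refine tendsto_of_tendsto_of_tendsto_of_le_of_le tendsto_const_nhds h0
      (fun _ => zero_le) fun n => ?_
    have h1 := hhol u (φ n - w) _ S.measurable.aestronglyMeasurable
      ((hφ n).hasGradientInD.sub hw) 1 zero_le_one (by linarith)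
    dsimp only
    rw [hA, mul_assoc, mul_assoc]
    refine le_trans ?_ (mul_le_mul' le_rfl h1)
    rw [← lintegral_const_mul' _ _ ENNReal.ofReal_ne_top]
    refine lintegral_mono fun x => ?_
    rw [← mul_sub, enorm_mul, enorm_mul, enorm_rpow_of_pos (S.pos x), ENNReal.rpow_one, mul_assoc]
    refine mul_le_mul' ?_ le_rfl
    rw [Real.enorm_eq_ofReal_abs]
    exact ENNReal.ofReal_le_ofReal (hC x)
  exact tendsto_nhds_unique (hl.congr fun n => S.weak _ (hφ n)) hr

end PositiveSolution

/-! ### Quadratic bounds along dilations -/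

/-- The weighted second order term in the expansion of `∫ K u^p |x|^{-bp} dx` along dilations. -/
noncomputable def dilRemainder {N : ℕ} (b p α : ℝ) (u : Euc N → ℝ) (t : ℝ) : ℝ≥0∞ :=
  ∫⁻ x, (‖dil α t u x‖ₑ ^ (p - 2) + ‖u x‖ₑ ^ (p - 2)) * ‖dil α t u x - u x‖ₑ ^ 2
    ∂powMeasure N (-(b * p))

theorem dil_neg_sub_exp_smul {N : ℕ} (α t : ℝ) (u : Euc N → ℝ) (x : Euc N) :
    Real.exp (α * t) * (dil α (-t) u (Real.exp t • x) - u (Real.exp t • x)) =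
      -(dil α t u x - u x) := by
  simp only [dil, smul_smul, ← Real.exp_add, neg_add_cancel, Real.exp_zero, one_smul, smul_eq_mul,
    mul_sub, ← mul_assoc, mul_neg, add_neg_cancel, one_mul]
  ring

/-- Young's inequality `A |t| √x ≤ x/4 + A² t²` leaves half of `x` to be absorbed on the left. -/
theorem le_of_le_sqrt_mul_add {x A B t : ℝ} (hx : 0 ≤ x)
    (h : x ≤ A * |t| * x ^ (1 / 2 : ℝ) + x / 4 + B * t ^ 2) :
    x ≤ 2 * (A ^ 2 + B) * t ^ 2 := by
  rw [← Real.sqrt_eq_rpow] at h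
  have h1 := Real.sq_sqrt hx
  nlinarith [sq_nonneg (Real.sqrt x / 2 - A * |t|), sq_abs t]

namespace PositiveSolution

variable {N : ℕ} {a b p α : ℝ} {K u : Euc N → ℝ} {G : Euc N → Euc N}

theorem hasGradientInD_dil (S : PositiveSolution a b p K u G) (h : CKNExponents N a b p α)
    (t : ℝ) : HasGradientInD a (dil α t u) (dil (α + 1) t G) :=
  S.grad.dil h.two_mul_add_one t

theorem hasGradientInD_dil_sub (S : PositiveSolution a b p K u G) (h : CKNExponents N a b p α)
    (t : ℝ) : HasGradientInD a (dil α t u - u) (dil (α + 1) t G - G) :=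
  (S.hasGradientInD_dil h t).sub S.grad

theorem lintegral_dil_rpow (h : CKNExponents N a b p α) (u : Euc N → ℝ) (t : ℝ) :
    ∫⁻ x, ‖dil α t u x‖ₑ ^ p ∂powMeasure N (-(b * p)) =
      ∫⁻ x, ‖u x‖ₑ ^ p ∂powMeasure N (-(b * p)) :=
  lintegral_enorm_dil_rpow (by have := h.two_lt; linarith) h.mul_p t u

theorem toReal_energy_dil_sub (S : PositiveSolution a b p K u G) (h : CKNExponents N a b p α)
    {C : ℝ} (hK : Continuous K) (hC : ∀ x, |K x| ≤ C) (t : ℝ) :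
    (energy a (dil (α + 1) t G - G)).toReal =
      -2 * ∫ x, K x * u x ^ (p - 1) * (dil α t u x - u x) ∂powMeasure N (-(b * p)) := by
  have := h.neZero
  rw [toReal_energy_sub S.grad.1 (S.hasGradientInD_dil h t).1
    (S.grad.energy_lt_top h.two_mul_lt).ne (energy_dil h.two_mul_add_one t G),
    S.weak_of_hasGradientInD h hK hC (S.hasGradientInD_dil_sub h t)]
  rfl

theorem integral_dil_neg (S : PositiveSolution a b p K u G) (h : CKNExponents N a b p α) (t : ℝ) :
    ∫ x, K x * u x ^ (p - 1) * (dil α (-t) u x - u x) ∂powMeasure N (-(b * p)) =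
      -∫ x, dil 0 t K x * dil α t u x ^ (p - 1) * (dil α t u x - u x)
        ∂powMeasure N (-(b * p)) := by
  rw [← integral_dil h.mul_p t, ← integral_neg]
  refine integral_congr_ae (Eventually.of_forall fun x => ?_)
  dsimp only
  rw [← mul_neg, ← dil_neg_sub_exp_smul]
  have e : Real.exp (α * p * t) = Real.exp (α * t) ^ (p - 1) * Real.exp (α * t) := by
    rw [← Real.exp_mul, ← Real.exp_add]
    ring_nf
  simp only [dil, smul_eq_mul, zero_mul, Real.exp_zero, one_mul]
  rw [e, Real.mul_rpow (Real.exp_pos _).le (S.pos _).le]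
  ring

/-- The formulas for `t` and `-t` are averaged, the second after dilating the variable. Each is only
linear in `u_t - u`; their average contains a difference of nonlinear terms, which supplies another
factor of size `|t|` or `|u_t - u|`. -/
theorem toReal_energy_eq_integral (S : PositiveSolution a b p K u G)
    (h : CKNExponents N a b p α) {C : ℝ} (hK : Continuous K) (hC : ∀ x, |K x| ≤ C) (t : ℝ) :
    (energy a (dil (α + 1) t G - G)).toReal =
      ∫ x, (dil 0 t K x * dil α t u x ^ (p - 1) * (dil α t u x - u x) -
        K x * u x ^ (p - 1) * (dil α t u x - u x)) ∂powMeasure N (-(b * p)) := by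
  have := h.neZero
  have e1 := S.toReal_energy_dil_sub h hK hC t
  have e2 := S.toReal_energy_dil_sub h hK hC (-t)
  rw [energy_dil_neg_sub h.two_mul_add_one, S.integral_dil_neg h] at e2
  have hw := S.hasGradientInD_dil_sub h t
  have hup := (h.lintegral_rpow_lt_top S.grad).ne
  have i1 := integrable_mul_rpow_mul h hK hC S.measurable S.pos hup hw
  have i2 := integrable_mul_rpow_mul h (L := dil 0 t K) (C := C) (v := dil α t u)
    ((continuous_dil_uncurry hK 0).comp (by fun_prop : Continuous fun x : Euc N => (x, t)))
    (fun x => by simpa [dil] using hC _) (S.measurable_dil t) (S.dil_pos t)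
    (by rwa [lintegral_dil_rpow h]) hw
  simp only [Pi.sub_apply] at i1 i2
  rw [integral_sub i2 i1]
  linarith

theorem lintegral_dil_potential (h : CKNExponents N a b p α) (u : Euc N → ℝ) (t : ℝ) :
    ∫⁻ x, ‖dil α t u x‖ₑ ^ (p - 2) * ‖dil α t u x - u x‖ₑ ^ 2 ∂powMeasure N (-(b * p)) =
      ∫⁻ x, ‖u x‖ₑ ^ (p - 2) * ‖dil α (-t) u x - u x‖ₑ ^ 2 ∂powMeasure N (-(b * p)) := by
  have hp := h.two_lt
  symm
  rw [← lintegral_exp_mul_comp_exp_smul h.mul_p t]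
  refine lintegral_congr fun x => ?_
  rw [← enorm_neg (dil α t u x - u x), ← dil_neg_sub_exp_smul]
  simp only [enorm_mul, mul_pow]
  have e : ENNReal.ofReal (Real.exp (α * p * t)) =
      ‖Real.exp (α * t)‖ₑ ^ (p - 2) * ‖Real.exp (α * t)‖ₑ ^ 2 := by
    rw [Real.enorm_of_nonneg (Real.exp_pos _).le, ENNReal.ofReal_rpow_of_pos (Real.exp_pos _),
      ← ENNReal.ofReal_pow (Real.exp_pos _).le, ← ENNReal.ofReal_mul (by positivity),
      ← Real.exp_mul, ← Real.exp_nat_mul, ← Real.exp_add]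
    push_cast
    ring_nf
  have e' : ‖dil α t u x‖ₑ ^ (p - 2) =
      ‖Real.exp (α * t)‖ₑ ^ (p - 2) * ‖u (Real.exp t • x)‖ₑ ^ (p - 2) := by
    rw [dil, smul_eq_mul, enorm_mul, ENNReal.mul_rpow_of_nonneg _ _ (by linarith)]
  rw [e, e']
  ring

/-- The half of the remainder with potential `u_t^{p-2}` becomes, after dilation, the half with
potential `u^{p-2}` for `-t`. The same bound holds for both, which explains the factor `2`. -/
theorem exists_dilRemainder_le (S : PositiveSolution a b p K u G)
    (h : CKNExponents N a b p α) {ε : ℝ≥0∞} (hε : 0 < ε) :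
    ∃ M : ℝ≥0∞, M ≠ ⊤ ∧ ∀ t, dilRemainder b p α u t ≤
      2 * (ε * energy a (dil (α + 1) t G - G) + M * ENNReal.ofReal |t| ^ 2) := by
  have := h.neZero
  obtain ⟨M, hM, hle⟩ := h.exists_lintegral_potential_le S.measurable
    (h.lintegral_rpow_lt_top S.grad).ne hε
  have key : ∀ t, ∫⁻ x, ‖u x‖ₑ ^ (p - 2) * ‖dil α t u x - u x‖ₑ ^ 2 ∂powMeasure N (-(b * p)) ≤
      ε * energy a (dil (α + 1) t G - G) + M * (8 * energy a G) * ENNReal.ofReal |t| ^ 2 := by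
    intro t
    refine (hle _ _ (S.hasGradientInD_dil_sub h t)).trans (add_le_add le_rfl ?_)
    rw [mul_assoc, mul_comm (8 * energy a G)]
    exact mul_le_mul' le_rfl
      (S.grad.lintegral_dil_sub_sq_le h.α_pos h.two_mul_add_one t)
  refine ⟨M * (8 * energy a G), ENNReal.mul_ne_top hM (ENNReal.mul_ne_top (by simp)
    (S.grad.energy_lt_top h.two_mul_lt).ne), fun t => ?_⟩
  have hum := S.measurable
  have hdm := S.measurable_dil (α := α) t
  unfold dilRemainder
  simp only [add_mul]
  rw [lintegral_add_left (by fun_prop), lintegral_dil_potential h, two_mul]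
  refine add_le_add ?_ (key t)
  have := key (-t)
  rwa [abs_neg, energy_dil_neg_sub h.two_mul_add_one] at this

/-- The integrand of `toReal_energy_eq_integral` is split by adding and subtracting `K u_t^{p-1}`:
one piece sees the variation of `K`, the other the variation of the power. -/
theorem exists_energy_le (S : PositiveSolution a b p K u G) (h : CKNExponents N a b p α)
    {C C₁ : ℝ} (hK : ContDiff ℝ 1 K) (hC : ∀ x, |K x| ≤ C)
    (hC₁ : ∀ x, |inner ℝ (gradient K x) x| ≤ C₁) :
    ∃ A B : ℝ≥0∞, A ≠ ⊤ ∧ B ≠ ⊤ ∧ ∀ t, energy a (dil (α + 1) t G - G) ≤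
      A * ENNReal.ofReal |t| * energy a (dil (α + 1) t G - G) ^ (1 / 2 : ℝ) +
        B * dilRemainder b p α u t := by
  have := h.neZero
  have hp := h.two_lt
  have hup := (h.lintegral_rpow_lt_top S.grad).ne
  have hC₁0 : 0 ≤ C₁ := (abs_nonneg _).trans (hC₁ 0)
  obtain ⟨C', hC', hhol⟩ := h.exists_hoelder_const
  refine ⟨ENNReal.ofReal C₁ *
    ((∫⁻ x, ‖u x‖ₑ ^ p ∂powMeasure N (-(b * p))) ^ ((p - 1) / p) * C' ^ (1 / p)),
    ENNReal.ofReal C * ENNReal.ofReal (p - 1), ENNReal.mul_ne_top ENNReal.ofReal_ne_top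
      (ENNReal.mul_ne_top
      (ENNReal.rpow_ne_top_of_nonneg (div_nonneg (by linarith) (by linarith)) hup)
      (ENNReal.rpow_ne_top_of_nonneg (by positivity) hC')),
    ENNReal.mul_ne_top ENNReal.ofReal_ne_top ENNReal.ofReal_ne_top, fun t => ?_⟩
  have hum := S.measurable
  have hdm := S.measurable_dil (α := α) t
  have hw := S.hasGradientInD_dil_sub h t
  have hpt : ∀ x, ‖dil 0 t K x * dil α t u x ^ (p - 1) * (dil α t u x - u x) -
        K x * u x ^ (p - 1) * (dil α t u x - u x)‖ₑ ≤
      ENNReal.ofReal C₁ * ENNReal.ofReal |t| *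
        (‖dil α t u x‖ₑ ^ (p - 1) * ‖dil α t u x - u x‖ₑ) +
      ENNReal.ofReal C * ENNReal.ofReal (p - 1) *
        ((‖dil α t u x‖ₑ ^ (p - 2) + ‖u x‖ₑ ^ (p - 2)) * ‖dil α t u x - u x‖ₑ ^ 2) := by
    intro x
    have e : dil 0 t K x * dil α t u x ^ (p - 1) * (dil α t u x - u x) -
        K x * u x ^ (p - 1) * (dil α t u x - u x) =
        (dil 0 t K x - K x) * dil α t u x ^ (p - 1) * (dil α t u x - u x) +
        K x * (dil α t u x ^ (p - 1) - u x ^ (p - 1)) * (dil α t u x - u x) := by ring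
    rw [e]
    refine (enorm_add_le _ _).trans (add_le_add ?_ ?_)
    · rw [enorm_mul, enorm_mul, enorm_rpow_of_pos (S.dil_pos t x), mul_assoc,
        ← ENNReal.ofReal_mul hC₁0, Real.enorm_eq_ofReal_abs (dil 0 t K x - K x)]
      exact mul_le_mul' (ENNReal.ofReal_le_ofReal (abs_dil_zero_sub_le hK hC₁ t x)) le_rfl
    · have h1 := enorm_rpow_sub_rpow_le (q := p - 1) (by linarith) (S.pos x)
        (S.dil_pos (α := α) t x)
      rw [show p - 1 - 1 = p - 2 by ring] at h1
      have h2 : ‖K x‖ₑ ≤ ENNReal.ofReal C := by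
        rw [Real.enorm_eq_ofReal_abs]
        exact ENNReal.ofReal_le_ofReal (hC x)
      rw [enorm_mul, enorm_mul]
      refine (mul_le_mul' (mul_le_mul' h2 h1) le_rfl).trans (le_of_eq ?_)
      ring
  have hE : energy a (dil (α + 1) t G - G) ≠ ⊤ := (hw.energy_lt_top h.two_mul_lt).ne
  calc energy a (dil (α + 1) t G - G)
      = ‖∫ x, (dil 0 t K x * dil α t u x ^ (p - 1) * (dil α t u x - u x) -
        K x * u x ^ (p - 1) * (dil α t u x - u x)) ∂powMeasure N (-(b * p))‖ₑ := by
        rw [← S.toReal_energy_eq_integral h hK.continuous hC t,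
          Real.enorm_of_nonneg ENNReal.toReal_nonneg, ENNReal.ofReal_toReal hE]
    _ ≤ _ := enorm_integral_le_lintegral_enorm _
    _ ≤ _ := lintegral_mono hpt
    _ = ENNReal.ofReal C₁ * ENNReal.ofReal |t| *
        (∫⁻ x, ‖dil α t u x‖ₑ ^ (p - 1) * ‖(dil α t u - u) x‖ₑ ^ (1 : ℝ)
          ∂powMeasure N (-(b * p))) +
        ENNReal.ofReal C * ENNReal.ofReal (p - 1) * dilRemainder b p α u t := by
        rw [lintegral_add_left (by fun_prop), lintegral_const_mul' _ _ (by finiteness),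
          lintegral_const_mul' _ _ (by finiteness), dilRemainder]
        simp only [ENNReal.rpow_one, Pi.sub_apply]
    _ ≤ _ := by
        refine add_le_add ?_ le_rfl
        have h1 := hhol (dil α t u) _ _ hdm.aestronglyMeasurable hw 1 zero_le_one (by linarith)
        rw [lintegral_dil_rpow h] at h1
        refine (mul_le_mul' le_rfl h1).trans (le_of_eq ?_)
        ring

/-- A positive weak solution is Lipschitz along dilations, with respect to the norm of
`D^{1,2}_a`. -/
theorem exists_energy_le_sq (S : PositiveSolution a b p K u G) (h : CKNExponents N a b p α)
    {C C₁ : ℝ} (hK : ContDiff ℝ 1 K) (hC : ∀ x, |K x| ≤ C)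
    (hC₁ : ∀ x, |inner ℝ (gradient K x) x| ≤ C₁) :
    ∃ c : ℝ, 0 ≤ c ∧ ∀ t, (energy a (dil (α + 1) t G - G)).toReal ≤ c * t ^ 2 := by
  have := h.neZero
  obtain ⟨A, B, hA, hB, hle⟩ := S.exists_energy_le h hK hC hC₁
  have hB0 : 0 ≤ B.toReal := ENNReal.toReal_nonneg
  -- This `ε` makes `B · 2ε ≤ 1/4`, so the energy on the right can be absorbed; the `+ 1` covers `B
  -- = 0`.
  obtain ⟨M, hM, hQ⟩ := S.exists_dilRemainder_le h
    (ε := ENNReal.ofReal (1 / (8 * (B.toReal + 1)))) (by simp; positivity)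
  have hM0 : 0 ≤ M.toReal := ENNReal.toReal_nonneg
  refine ⟨2 * (A.toReal ^ 2 + 2 * B.toReal * M.toReal), by positivity, fun t => ?_⟩
  set E := energy a (dil (α + 1) t G - G) with hEdef
  have hE : E ≠ ⊤ := ((S.hasGradientInD_dil_sub h t).energy_lt_top h.two_mul_lt).ne
  have hE0 : 0 ≤ E.toReal := ENNReal.toReal_nonneg
  refine le_of_le_sqrt_mul_add hE0 ?_
  have h1 := (hle t).trans (add_le_add le_rfl (mul_le_mul' le_rfl (hQ t)))
  rw [← hEdef] at h1
  have hE2 : E ^ (1 / 2 : ℝ) ≠ ⊤ := ENNReal.rpow_ne_top_of_nonneg (by norm_num) hE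
  have h2 := ENNReal.toReal_mono (by finiteness) h1
  rw [ENNReal.toReal_add (by finiteness) (by finiteness)] at h2
  simp only [ENNReal.toReal_mul, ENNReal.toReal_ofReal (abs_nonneg t), ← ENNReal.toReal_rpow] at h2
  rw [ENNReal.toReal_add (by finiteness) (by finiteness)] at h2
  simp only [ENNReal.toReal_mul, ENNReal.toReal_pow, ENNReal.toReal_ofReal (abs_nonneg t), sq_abs,
    ENNReal.toReal_ofNat,
    ENNReal.toReal_ofReal (by positivity : 0 ≤ 1 / (8 * (B.toReal + 1)))] at h2
  refine h2.trans ?_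
  have h3 : B.toReal * (2 * (1 / (8 * (B.toReal + 1)) * E.toReal)) ≤ E.toReal / 4 := by
    have h4 : B.toReal / (B.toReal + 1) ≤ 1 := by
      rw [div_le_one (by positivity)]; linarith
    calc _ = B.toReal / (B.toReal + 1) * (E.toReal / 4) := by field_simp; ring
      _ ≤ _ := mul_le_of_le_one_left (by positivity) h4
  linarith

theorem exists_dilRemainder_le_sq (S : PositiveSolution a b p K u G)
    (h : CKNExponents N a b p α)
    {C C₁ : ℝ} (hK : ContDiff ℝ 1 K) (hC : ∀ x, |K x| ≤ C)
    (hC₁ : ∀ x, |inner ℝ (gradient K x) x| ≤ C₁) :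
    ∃ c : ℝ, 0 ≤ c ∧ ∀ t, dilRemainder b p α u t ≤ ENNReal.ofReal (c * t ^ 2) := by
  have := h.neZero
  obtain ⟨c, hc0, hc⟩ := S.exists_energy_le_sq h hK hC hC₁
  obtain ⟨M, hM, hQ⟩ := S.exists_dilRemainder_le h (ε := 1) one_pos
  refine ⟨2 * (c + M.toReal), by positivity, fun t => (hQ t).trans ?_⟩
  have hE := ((S.hasGradientInD_dil_sub h t).energy_lt_top h.two_mul_lt).ne
  have h1 : energy a (dil (α + 1) t G - G) ≤ ENNReal.ofReal (c * t ^ 2) := by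
    rw [← ENNReal.ofReal_toReal hE]
    exact ENNReal.ofReal_le_ofReal (hc t)
  have h2 : M * ENNReal.ofReal |t| ^ 2 = ENNReal.ofReal (M.toReal * t ^ 2) := by
    rw [ENNReal.ofReal_mul ENNReal.toReal_nonneg, ENNReal.ofReal_toReal hM,
      ← ENNReal.ofReal_pow (abs_nonneg t), sq_abs]
  rw [one_mul, h2, mul_assoc, ENNReal.ofReal_mul (p := 2) (by norm_num), add_mul,
    ENNReal.ofReal_add (by positivity) (by positivity), ENNReal.ofReal_ofNat]
  exact mul_le_mul' le_rfl (add_le_add h1 le_rfl)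

end PositiveSolution

/-! ### The Pohozaev identity -/

namespace PositiveSolution

variable {N : ℕ} {a b p α : ℝ} {K u : Euc N → ℝ} {G : Euc N → Euc N}

theorem integrable_rpow (S : PositiveSolution a b p K u G) (h : CKNExponents N a b p α) :
    Integrable (fun x => u x ^ p) (powMeasure N (-(b * p))) := by
  refine ⟨(S.measurable.pow_const p).aestronglyMeasurable,
    lt_of_le_of_lt (le_of_eq (lintegral_congr fun x => ?_)) (h.lintegral_rpow_lt_top S.grad)⟩
  exact enorm_rpow_of_pos (S.pos x) p

theorem integral_mul_dil_rpow (S : PositiveSolution a b p K u G) (h : CKNExponents N a b p α)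
    (t : ℝ) : ∫ x, dil 0 (-t) K x * u x ^ p ∂powMeasure N (-(b * p)) =
      ∫ x, K x * dil α t u x ^ p ∂powMeasure N (-(b * p)) := by
  rw [← integral_dil h.mul_p t]
  refine integral_congr_ae (Eventually.of_forall fun x => ?_)
  simp only [dil, smul_smul, ← Real.exp_add, neg_add_cancel, Real.exp_zero, one_smul, smul_eq_mul,
    zero_mul, one_mul]
  rw [Real.mul_rpow (Real.exp_pos _).le (S.pos _).le, ← Real.exp_mul]
  ring_nf

/-- The dilation is moved from `K` onto `u`. The first order Taylor term is then `-(p/2)` times the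
energy of `u_t - u`, so it is already quadratic in `t`, and the Taylor remainder is bounded by
`dilRemainder`. -/
theorem exists_abs_integral_sub_le (S : PositiveSolution a b p K u G)
    (h : CKNExponents N a b p α) {C C₁ : ℝ} (hK : ContDiff ℝ 1 K) (hC : ∀ x, |K x| ≤ C)
    (hC₁ : ∀ x, |inner ℝ (gradient K x) x| ≤ C₁) :
    ∃ c : ℝ, ∀ t, |∫ x, dil 0 t K x * u x ^ p ∂powMeasure N (-(b * p)) -
      ∫ x, K x * u x ^ p ∂powMeasure N (-(b * p))| ≤ c * t ^ 2 := by
  have := h.neZero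
  have hp := h.two_lt
  have hp1 : 0 ≤ 2 * p * (p - 1) := mul_nonneg (by linarith) (by linarith)
  have hC0 : 0 ≤ C := (abs_nonneg _).trans (hC 0)
  obtain ⟨c₁, hc₁0, hc₁⟩ := S.exists_energy_le_sq h hK hC hC₁
  obtain ⟨c₂, hc₂0, hc₂⟩ := S.exists_dilRemainder_le_sq h hK hC hC₁
  have key : ∀ t, |∫ x, K x * dil α t u x ^ p ∂powMeasure N (-(b * p)) -
      ∫ x, K x * u x ^ p ∂powMeasure N (-(b * p))| ≤
        (C * (2 * p * (p - 1)) * c₂ + p * c₁) * t ^ 2 := by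
    intro t
    have i1 : Integrable (fun x => K x * u x ^ p) (powMeasure N (-(b * p))) :=
      (S.integrable_rpow h).bdd_mul (c := C) hK.continuous.aestronglyMeasurable
        (Eventually.of_forall hC)
    have i2 : Integrable (fun x => K x * dil α t u x ^ p) (powMeasure N (-(b * p))) := by
      have : Integrable (fun x => dil α t u x ^ p) (powMeasure N (-(b * p))) := by
        refine ⟨((S.measurable_dil t).pow_const p).aestronglyMeasurable, ?_⟩
        rw [hasFiniteIntegral_iff_enorm]
        simp only [enorm_rpow_of_pos (S.dil_pos t _)]
        rw [lintegral_dil_rpow h]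
        exact h.lintegral_rpow_lt_top S.grad
      exact this.bdd_mul (c := C) hK.continuous.aestronglyMeasurable (Eventually.of_forall hC)
    have i3 : Integrable (fun x => K x * u x ^ (p - 1) * (dil α t u x - u x))
        (powMeasure N (-(b * p))) :=
      integrable_mul_rpow_mul h hK.continuous hC S.measurable S.pos
        (h.lintegral_rpow_lt_top S.grad).ne (S.hasGradientInD_dil_sub h t)
    set R : Euc N → ℝ := fun x => K x *
      (dil α t u x ^ p - u x ^ p - p * u x ^ (p - 1) * (dil α t u x - u x)) with hR
    have e : ∀ x, R x = (K x * dil α t u x ^ p - K x * u x ^ p) -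
        p * (K x * u x ^ (p - 1) * (dil α t u x - u x)) := fun x => by
      simp only [hR]; ring
    have e1 := integral_congr_ae (μ := powMeasure N (-(b * p))) (Eventually.of_forall e)
    rw [integral_sub (f := fun x => K x * dil α t u x ^ p - K x * u x ^ p) (i2.sub i1)
      (i3.const_mul p), integral_sub i2 i1, integral_const_mul] at e1
    have e2 := S.toReal_energy_dil_sub h hK.continuous hC t
    have e3 : |∫ x, R x ∂powMeasure N (-(b * p))| ≤ C * (2 * p * (p - 1)) * (c₂ * t ^ 2) := by
      have h1 : ‖∫ x, R x ∂powMeasure N (-(b * p))‖ₑ ≤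
          ENNReal.ofReal (C * (2 * p * (p - 1)) * (c₂ * t ^ 2)) := by
        refine (enorm_integral_le_lintegral_enorm _).trans ?_
        rw [ENNReal.ofReal_mul (by positivity), ENNReal.ofReal_mul hC0]
        refine le_trans ?_ (mul_le_mul' le_rfl (hc₂ t))
        rw [dilRemainder, ← lintegral_const_mul' _ _ (by finiteness)]
        refine lintegral_mono fun x => ?_
        rw [hR, enorm_mul, mul_assoc (ENNReal.ofReal C)]
        refine mul_le_mul' ?_ (enorm_rpow_sub_sub_le hp.le (S.pos x) (S.dil_pos t x))
        rw [Real.enorm_eq_ofReal_abs]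
        exact ENNReal.ofReal_le_ofReal (hC x)
      rw [Real.enorm_eq_ofReal_abs] at h1
      exact (ENNReal.ofReal_le_ofReal_iff (by positivity)).1 h1
    have e4 := hc₁ t
    have e5 : 0 ≤ (energy a (dil (α + 1) t G - G)).toReal := ENNReal.toReal_nonneg
    have e6 : ∫ x, K x * dil α t u x ^ p ∂powMeasure N (-(b * p)) -
        ∫ x, K x * u x ^ p ∂powMeasure N (-(b * p)) =
        ∫ x, R x ∂powMeasure N (-(b * p)) -
          p / 2 * (energy a (dil (α + 1) t G - G)).toReal := by
      rw [e1, e2]; ring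
    rw [e6]
    refine (abs_sub _ _).trans ?_
    rw [abs_of_nonneg (mul_nonneg (by linarith) e5 :
      0 ≤ p / 2 * (energy a (dil (α + 1) t G - G)).toReal)]
    have e7 : p / 2 * (energy a (dil (α + 1) t G - G)).toReal ≤ p * (c₁ * t ^ 2) :=
      mul_le_mul (by linarith) e4 e5 (by linarith)
    linarith
  refine ⟨C * (2 * p * (p - 1)) * c₂ + p * c₁, fun t => ?_⟩
  have := key (-t)
  rwa [← S.integral_mul_dil_rpow h, neg_neg, neg_sq] at this

theorem integrable_inner_gradient (S : PositiveSolution a b p K u G)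
    (h : CKNExponents N a b p α) {C₁ : ℝ} (hK : ContDiff ℝ 1 K)
    (hC₁ : ∀ x, |inner ℝ (gradient K x) x| ≤ C₁) :
    Integrable (fun x => inner ℝ (gradient K x) x * u x ^ p) (powMeasure N (-(b * p))) :=
  (S.integrable_rpow h).bdd_mul (c := C₁)
    ((continuous_gradient hK).inner continuous_id).aestronglyMeasurable (Eventually.of_forall hC₁)

/-- The Pohozaev identity. -/
theorem integral_inner_gradient (S : PositiveSolution a b p K u G)
    (h : CKNExponents N a b p α) {C C₁ : ℝ} (hK : ContDiff ℝ 1 K) (hC : ∀ x, |K x| ≤ C)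
    (hC₁ : ∀ x, |inner ℝ (gradient K x) x| ≤ C₁) :
    ∫ x, inner ℝ (gradient K x) x * u x ^ p ∂powMeasure N (-(b * p)) = 0 := by
  obtain ⟨c, hc⟩ := S.exists_abs_integral_sub_le h hK hC hC₁
  have hcont : ∀ {L : Euc N → ℝ}, Continuous L → ∀ t, Continuous (dil 0 t L) := fun hL t =>
    (continuous_dil_uncurry hL 0).comp (by fun_prop : Continuous fun x : Euc N => (x, t))
  have hum := (S.measurable.pow_const p).aestronglyMeasurable (μ := powMeasure N (-(b * p)))
  have hu0 : ∀ x, 0 ≤ u x ^ p := fun x => Real.rpow_nonneg (S.pos x).le p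
  -- The derivative at `0` of `t ↦ ∫ K(e^t x) u^p |x|^{-bp}` is computed twice: under the integral
  -- sign, where it is the desired integral, and from the quadratic bound, where it is `0`.
  have h1 := (hasDerivAt_integral_of_dominated_loc_of_deriv_le (μ := powMeasure N (-(b * p)))
    (F := fun t x => dil 0 t K x * u x ^ p) (F' := fun t x => dil 0 t (euler 0 K) x * u x ^ p)
    (x₀ := 0) (s := Set.univ) (bound := fun x => C₁ * u x ^ p) univ_mem
    (Eventually.of_forall fun t => (hcont hK.continuous t).aestronglyMeasurable.mul hum)
    ?_ ((hcont (continuous_euler hK 0) 0).aestronglyMeasurable.mul hum)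
    (Eventually.of_forall fun x t _ => ?_) ((S.integrable_rpow h).const_mul C₁)
    (Eventually.of_forall fun x t _ => (hasDerivAt_dil hK 0 t x).mul_const _)).2
  · have h2 : HasDerivAt (fun t => ∫ x, dil 0 t K x * u x ^ p ∂powMeasure N (-(b * p))) 0 0 := by
      rw [hasDerivAt_iff_isLittleO_nhds_zero]
      have : (fun t : ℝ => t ^ 2) =o[𝓝 0] fun t : ℝ => t := Asymptotics.isLittleO_pow_id one_lt_two
      refine Asymptotics.IsBigO.trans_isLittleO (Asymptotics.IsBigO.of_bound c ?_) this
      refine Eventually.of_forall fun t => ?_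
      simp only [zero_add, smul_zero, sub_zero, dil_zero]
      rw [Real.norm_eq_abs, Real.norm_of_nonneg (sq_nonneg t)]
      exact hc t
    have h3 := h1.unique h2
    simpa only [dil_zero, euler, zero_mul, zero_add] using h3
  · simp only [dil_zero]
    exact (S.integrable_rpow h).bdd_mul (c := C) hK.continuous.aestronglyMeasurable
      (Eventually.of_forall hC)
  · rw [norm_mul, Real.norm_of_nonneg (hu0 x)]
    refine mul_le_mul_of_nonneg_right ?_ (hu0 x)
    simp only [dil, euler, zero_mul, zero_add, Real.exp_zero, one_smul]
    exact hC₁ _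

end PositiveSolution

/-! ### Return to the original formulation and nonexistence -/

theorem rpow_neg_smul_mul {N : ℕ} (x : Euc N) (c k y : ℝ) :
    ‖x‖ ^ (-c) • (k * y) = k * (y / ‖x‖ ^ c) := by
  rw [Real.rpow_neg (norm_nonneg x), smul_eq_mul]
  ring

theorem IsPositiveWeakSolution.exists_positiveSolution {N : ℕ} [NeZero N] {a b p : ℝ}
    {K u : Euc N → ℝ} (hu : IsPositiveWeakSolution a b p K u) :
    ∃ v G, v =ᵐ[volume] u ∧ PositiveSolution a b p K v G := by
  obtain ⟨hpos, G, hG, hweak⟩ := hu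
  have hum := hG.aestronglyMeasurable.aemeasurable
  -- The value `1` on the exceptional null set makes the representative positive everywhere, so the
  -- power identities hold pointwise even after dilation.
  let v : Euc N → ℝ := fun x => if 0 < hum.mk u x then hum.mk u x else 1
  have hvu : v =ᵐ[volume] u := by
    filter_upwards [hpos, hum.ae_eq_mk] with x hx h1
    simp only [v]
    rw [if_pos (h1 ▸ hx), h1]
  refine ⟨v, G, hvu, ?_, fun x => ?_, hG.congr hvu.symm (ae_eq_refl G), fun φ hφ => ?_⟩
  · exact Measurable.ite (measurableSet_lt measurable_const hum.measurable_mk) hum.measurable_mk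
      measurable_const
  · simp only [v]
    split_ifs with h
    · exact h
    · exact one_pos
  · rw [integral_powMeasure, integral_powMeasure]
    refine (hweak φ hφ).trans (integral_congr_ae ?_)
    filter_upwards [hvu] with x hx
    rw [hx, mul_assoc, rpow_neg_smul_mul]
    ring

/-- `K` is constant along `t ↦ e^t x`, which tends to the origin as `t → -∞`. -/
theorem eq_of_inner_gradient_eq_zero {N : ℕ} {K : Euc N → ℝ} (hK : ContDiff ℝ 1 K)
    (h : ∀ x, inner ℝ (gradient K x) x = 0) (x : Euc N) : K x = K 0 := by
  have h1 : ∀ t, K (Real.exp t • x) = K x := fun t => by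
    have := abs_dil_zero_sub_le (C := 0) hK (fun y => by simp [h y]) t x
    rw [zero_mul, abs_nonpos_iff, sub_eq_zero] at this
    simpa [dil] using this
  have h2 : Tendsto (fun t => K (Real.exp t • x)) atBot (𝓝 (K 0)) := by
    refine (hK.continuous.tendsto 0).comp ?_
    simpa using Real.tendsto_exp_atBot.smul_const x
  simp only [h1] at h2
  exact tendsto_nhds_unique tendsto_const_nhds h2

theorem corollary2p3 (N : ℕ) (hN : 3 ≤ N) (a b p : ℝ)
    (ha : a < ((N : ℝ) - 2) / 2) (hab : a ≤ b) (hba : b < a + 1)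
    (hp : p = 2 * (N : ℝ) / ((N : ℝ) - 2 * (1 + a - b)))
    (K : EuclideanSpace ℝ (Fin N) → ℝ) (hK : ContDiff ℝ 1 K)
    (hKbdd : ∃ C : ℝ, ∀ x, |K x| ≤ C)
    (hKgrad : ∃ C : ℝ, ∀ x, |inner ℝ (gradient K x) x| ≤ C) :
    (∀ u : EuclideanSpace ℝ (Fin N) → ℝ, IsPositiveWeakSolution a b p K u →
      Integrable (fun x => inner ℝ (gradient K x) x * (u x ^ p / ‖x‖ ^ (b * p))) volume ∧
      ∫ x, inner ℝ (gradient K x) x * (u x ^ p / ‖x‖ ^ (b * p)) = 0) ∧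
    (((∀ x, 0 ≤ inner ℝ (gradient K x) x) ∨ (∀ x, inner ℝ (gradient K x) x ≤ 0)) →
      (¬ ∃ c : ℝ, ∀ x, K x = c) →
      ¬ ∃ u : EuclideanSpace ℝ (Fin N) → ℝ, IsPositiveWeakSolution a b p K u) := by
  obtain ⟨C, hC⟩ := hKbdd
  obtain ⟨C₁, hC₁⟩ := hKgrad
  have h : CKNExponents N a b p ((N - 2 - 2 * a) / 2) := ⟨hN, ha, hab, hba, hp, rfl⟩
  have := h.neZero
  have main : ∀ u : EuclideanSpace ℝ (Fin N) → ℝ, IsPositiveWeakSolution a b p K u →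
      Integrable (fun x => inner ℝ (gradient K x) x * (u x ^ p / ‖x‖ ^ (b * p))) volume ∧
      ∫ x, inner ℝ (gradient K x) x * (u x ^ p / ‖x‖ ^ (b * p)) = 0 := by
    intro u hu
    obtain ⟨v, G, hvu, S⟩ := hu.exists_positiveSolution
    have e : (fun x => ‖x‖ ^ (-(b * p)) • (inner ℝ (gradient K x) x * v x ^ p)) =ᵐ[volume]
        fun x => inner ℝ (gradient K x) x * (u x ^ p / ‖x‖ ^ (b * p)) := by
      filter_upwards [hvu] with x hx
      rw [hx, rpow_neg_smul_mul]
    have h1 := S.integral_inner_gradient h hK hC hC₁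
    rw [integral_powMeasure, integral_congr_ae e] at h1
    exact ⟨(integrable_congr e).1
      (integrable_powMeasure_iff.1 (S.integrable_inner_gradient h hK hC₁)), h1⟩
  refine ⟨main, fun hsign hconst => ?_⟩
  rintro ⟨u, hu⟩
  obtain ⟨hint, hzero⟩ := main u hu
  have hw : ∀ᵐ x : Euc N, 0 < u x ^ p / ‖x‖ ^ (b * p) := by
    filter_upwards [hu.1, ae_ne_zero_euc] with x hx hx0
    have := norm_pos_iff.2 hx0
    positivity
  have hae : (fun x => inner ℝ (gradient K x) x * (u x ^ p / ‖x‖ ^ (b * p))) =ᵐ[volume] 0 := by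
    rcases hsign with hs | hs
    · refine (integral_eq_zero_iff_of_nonneg_ae ?_ hint).1 hzero
      filter_upwards [hw] with x hx using mul_nonneg (hs x) hx.le
    · have h1 := (integral_eq_zero_iff_of_nonneg_ae ?_ hint.neg).1
        (by simp only [Pi.neg_apply, integral_neg, hzero, neg_zero])
      · filter_upwards [h1] with x hx using neg_eq_zero.1 hx
      · filter_upwards [hw] with x hx
        exact neg_nonneg.2 (mul_nonpos_of_nonpos_of_nonneg (hs x) hx.le)
  have hae' : (fun x => inner ℝ (gradient K x) x) =ᵐ[volume] fun _ : Euc N => (0 : ℝ) := by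
    filter_upwards [hae, hw] with x hx hx'
    exact (mul_eq_zero.1 hx).resolve_right hx'.ne'
  -- Continuity of `∇K · x` upgrades its vanishing almost everywhere to vanishing everywhere.
  have hall := (Continuous.ae_eq_iff_eq volume
    ((continuous_gradient hK).inner continuous_id) continuous_const).1 hae'
  exact hconst ⟨K 0, eq_of_inner_gradient_eq_zero hK fun x => congrFun hall x⟩
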